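/- Let $p>1$, $p'=\min(p,2)$, $b\in(1/p',1)$, and let $(k_n)_{n\ge1}$ be an arbitrary nondecreasing sequence of positive integers. For each $i\ge1$ let $(\epsilon_{i,s})_{s\in\mathbb Z}$ be i.i.d., and let $x_{i,t}=g_{i,t}(\epsilon_{i,t},\epsilon_{i,t-1},\dots)$, $t\ge1$, with measurable $g_{i,t}$, $\mathbb E x_{i,t}=0$ and $\mathbb E|x_{i,t}|^p<\infty$. (No assumption is made on the joint law of the innovations for different $i$.) Let $(\epsilon'_{i,s})_s$ be an independent copy of $(\epsilon_{i,s})_s$, let $x'_{i,t}(m)$ be $x_{i,t}$ with $\epsilon_{i,t-m}$ replaced by $\epsilon'_{i,t-m}$, and put $\theta^{(p)}_{i,t}(m)=\|x_{i,t}-x'_{i,t}(m)\|_p$, where $\|\cdot\|_p=(\mathbb E|\cdot|^p)^{1/p}$. Suppose: 1. (physical dependence over $t$) $\Theta^{(p)}_{i,t}=\sum_{m\ge0}\theta^{(p)}_{i,t}(m)<\infty$ for all $i,t$, and $\theta^{(p)}_{i,t}(m)\le d_{i,t}\,\psi_{i,m}$ for all $i,t\ge 1$, $m\ge0$, with constants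 $d_{i,t},\psi_{i,m}\ge0$ such that $\sup_{i}\psi_{i,m}\le C\max(m,1)^{-\lambda-\iota}$ for some $C$, $\lambda\ge1$, $\iota>0$ and all $m\ge 0$; if $p>2$, also $d_{i,t}\le 2\|x_{i,t}\|_p$ for all $i,t$; 2. (martingale over $i$) for each $n$ there is a filtration $(\mathfrak F_{i,n})_i$ such that $x_{i,t}$ is $\mathfrak F_{i,n}$-measurable for $1\le i\le k_n$, $1\le t\le n$, and $\mathbb E[x_{i+1,t}\mid\mathfrak F_{i,n}]=x_{i,t}$ a.s. for $1\le i<k_n$, $1\le t\le n$; 3. $\displaystyle\limsup_{n\to\infty}\sum_{s=1}^\infty\max_{1\le i\le k_n}\Big(\frac{d_{i,s}}{s^b}\Big)^p<\infty$; 4. $\displaystyle\max_{1\le i\le k_n,\,1\le t\le n}\mathbb E|x_{i,t}|^p=o\big(n^{p(1-b)}\big)$ as $n\to\infty$. Then $\mathcal M_n:=\max_{1\le i\le k_n}\Big|\frac1n\sum_{t=1}^n x_{i,t}\Big|\to0$ almost surely as $n\to\infty$. -/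

import Mathlib

open MeasureTheory ProbabilityTheory Filter Topology
open scoped NNReal ENNReal

noncomputable section

namespace MaxLLN

variable {Ω E : Type*}

/-- The causal process `x_{i,t} = g_{i,t}(ε_{i,t}, ε_{i,t-1}, ε_{i,t-2}, …)`. The argument of
`g i t` is the sequence whose `j`-th entry is the innovation with time index `t - j`. -/
def causalProcess (g : ℕ → ℕ → (ℕ → E) → ℝ) (ε : ℕ → ℤ → Ω → E) (i t : ℕ) (ω : Ω) : ℝ :=
  g i t (fun j => ε i ((t : ℤ) - (j : ℤ)) ω)

/-- The coupled process `x'_{i,t}(m)`: the innovation with time index `t - m` is replaced by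
that of an independent copy of `(ε_{i,t})_t`. The pair (sequence, independent copy) is realised on
`Ω × Ω` under the product measure: the sequence is read off the first factor and its copy off
the second. -/
def coupledProcess (g : ℕ → ℕ → (ℕ → E) → ℝ) (ε : ℕ → ℤ → Ω → E) (i t m : ℕ) (w : Ω × Ω) : ℝ :=
  g i t (fun j => if j = m then ε i ((t : ℤ) - (j : ℤ)) w.2 else ε i ((t : ℤ) - (j : ℤ)) w.1)

/-- The physical dependence measure `θ_{i,t}^{(p)}(m) = ‖x_{i,t} - x'_{i,t}(m)‖_p`. -/
def physDep [MeasurableSpace Ω] (μ : Measure Ω) (p : ℝ) (g : ℕ → ℕ → (ℕ → E) → ℝ)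
    (ε : ℕ → ℤ → Ω → E) (i t m : ℕ) : ℝ≥0∞ :=
  eLpNorm (fun w : Ω × Ω => causalProcess g ε i t w.1 - coupledProcess g ε i t m w)
    (ENNReal.ofReal p) (μ.prod μ)

/-- The accumulated dependence measure `Θ_{i,t}^{(p)} = ∑_{m ≥ 0} θ_{i,t}^{(p)}(m)`. -/
def accPhysDep [MeasurableSpace Ω] (μ : Measure Ω) (p : ℝ) (g : ℕ → ℕ → (ℕ → E) → ℝ)
    (ε : ℕ → ℤ → Ω → E) (i t : ℕ) : ℝ≥0∞ :=
  ∑' m : ℕ, physDep μ p g ε i t m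

/-- `M_n = max_{1 ≤ i ≤ k_n} |(1/n) ∑_{t=1}^n x_{i,t}|`. -/
def maxMean (x : ℕ → ℕ → Ω → ℝ) (k : ℕ → ℕ) (n : ℕ) (ω : Ω) : ℝ≥0 :=
  (Finset.Icc 1 (k n)).sup fun i => ‖(1 / (n : ℝ)) * ∑ t ∈ Finset.Icc 1 n, x i t ω‖₊

/-- `max_{1 ≤ i ≤ k_n, 1 ≤ t ≤ n} E|x_{i,t}|^p`. -/
def maxMoment [MeasurableSpace Ω] (μ : Measure Ω) (p : ℝ) (x : ℕ → ℕ → Ω → ℝ) (k : ℕ → ℕ)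
    (n : ℕ) : ℝ≥0∞ :=
  (Finset.Icc 1 (k n)).sup fun i => (Finset.Icc 1 n).sup fun t => ∫⁻ ω, ‖x i t ω‖ₑ ^ p ∂μ

/-- `∑_{s ≥ 1} max_{1 ≤ i ≤ k} (d_{i,s} / s^b)^p`, a sum in `[0, ∞]`. -/
def weightSum (d : ℕ → ℕ → ℝ≥0) (b p : ℝ) (k : ℕ) : ℝ≥0∞ :=
  ∑' s : ℕ, (((Finset.Icc 1 k).sup fun i =>
    (d i (s + 1) / ((s + 1 : ℕ) : ℝ≥0) ^ b) ^ p : ℝ≥0) : ℝ≥0∞)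

end MaxLLN

end

namespace MaxLLN

/-! The two structures act in different directions: the martingale property in `i` removes the
maximum over series, and physical dependence in `t` controls a single series.

For fixed `N`, let `Y i n` be the partial sum of length `n` of series `i`. Each `Y i n` is a
martingale in `i` for one common filtration, so `max_{n ≤ N} |Y i n|` is a submartingale in `i`.
Doob's weak type inequality then bounds the maximum over all `i ≤ k N` by the expectation for the
last series alone (`mul_measure_sup_martingale_le`). The growth of `k` therefore costs nothing.

For one series, each centered causal variable is the sum over lags `m` of its projections `E[x_t |
G_{t-m}] - E[x_t | G_{t-m-1}]`, where `G_s` is generated by the innovations up to time `s`. At a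
fixed lag these are martingale differences in `t`, with `q`-th moments at most `θ(m)^q`
(`lintegral_projection_le`). With `q = min p 2`, a maximal inequality for martingale differences
(`lintegral_sup_partialSum_le`) is applied lag by lag and summed (`lintegral_sup_causal_le`). Since
`ψ` has a summable majorant uniform in `i`, the expected maximum is `O((∑_{s ≤ N} d_s^q)^{1/q})`.

This is `O(N^a)` with `a < 1`: for `p ≤ 2` the weighted sum gives `a = b`, and for `p > 2` the
moment growth gives `a = 3/2 - b`. Borel–Cantelli along dyadic blocks finishes the proof
(`ae_tendsto_zero_of_dyadic`). -/

/-- One-step pathwise bound for the potential `m + x²/m`, with `x` a martingale and `m` its running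
maximum. The linear term in `d` has a bounded previsible coefficient and vanishes in expectation,
which leaves a pure `q`-th moment cost. Small jumps use the quadratic expansion, large jumps a crude
bound; `1 ≤ m` lets both be measured by `|d| ^ q`. -/
theorem maximal_potential_step {q x m d : ℝ} (hq₁ : 1 ≤ q) (hq₂ : q ≤ 2) (hm : 1 ≤ m)
    (hx : |x| ≤ m) :
    max m |x + d| + (x + d) ^ 2 / max m |x + d|
      ≤ m + x ^ 2 / m + 2 * (x / m) * d + 5 * |d| ^ q := by
  have hm0 : 0 < m := by linarith
  have hd0 : 0 ≤ |d| := abs_nonneg d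
  have hxm : |x / m| ≤ 1 := by rwa [abs_div, abs_of_pos hm0, div_le_one hm0]
  have hx0 : 0 ≤ x ^ 2 / m := by positivity
  have hxd : |x + d| ≤ |x| + |d| := abs_add_le x d
  have hsq : (x + d) ^ 2 = |x + d| ^ 2 := (sq_abs _).symm
  rcases le_or_gt |d| (2 * m) with hd | hd
  · have h1 : d ^ 2 / m ≤ 4 * |d| ^ q := by
      rw [div_le_iff₀ hm0, ← sq_abs]
      rcases hd0.eq_or_lt with h0 | h0
      · rw [← h0]
        have : (0:ℝ) ≤ 0 ^ q := by positivity
        nlinarith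
      · have e : |d| ^ 2 = |d| ^ q * |d| ^ (2 - q) := by
          rw [← Real.rpow_add h0, ← Real.rpow_natCast]; norm_num
        have h2 : |d| ^ (2 - q) ≤ 4 * m := by
          calc |d| ^ (2 - q) ≤ (2 * m) ^ (2 - q) :=
                Real.rpow_le_rpow hd0 hd (by linarith)
            _ ≤ (2 * m) ^ (1 : ℝ) :=
                Real.rpow_le_rpow_of_exponent_le (by linarith) (by linarith)
            _ ≤ 4 * m := by rw [Real.rpow_one]; linarith
        rw [e]
        calc |d| ^ q * |d| ^ (2 - q) ≤ |d| ^ q * (4 * m) := by gcongr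
          _ = _ := by ring
    -- For fixed `y`, the map `M ↦ M + y²/M` is least at `M = |y|`, so raising `M` from `m` to `|y|`
    -- can only lower the potential.
    have h2 : max m |x + d| + (x + d) ^ 2 / max m |x + d| ≤ m + (x + d) ^ 2 / m := by
      rcases le_total |x + d| m with h | h
      · rw [max_eq_left h]
      · rw [max_eq_right h, hsq]
        have h3 : 0 < |x + d| := by linarith
        have : |x + d| ^ 2 / |x + d| = |x + d| := by field_simp
        rw [this, ← sub_nonneg]
        have : m + |x + d| ^ 2 / m - (|x + d| + |x + d|) = (|x + d| - m) ^ 2 / m := by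
          field_simp; ring
        rw [this]; positivity
    have h3 : m + (x + d) ^ 2 / m = m + x ^ 2 / m + 2 * (x / m) * d + d ^ 2 / m := by
      field_simp; ring
    have h4 : 0 ≤ |d| ^ q := by positivity
    linarith
  · have h1 : |d| ≤ |d| ^ q := by
      conv_lhs => rw [← Real.rpow_one |d|]
      exact Real.rpow_le_rpow_of_exponent_le (by linarith) hq₁
    have h2 : -|d| ≤ x / m * d := by
      have := neg_abs_le (x / m * d)
      rw [abs_mul] at this
      nlinarith
    have hM : 0 < max m |x + d| := lt_max_of_lt_left hm0
    have h3 : (x + d) ^ 2 / max m |x + d| ≤ max m |x + d| := by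
      rw [div_le_iff₀ hM, hsq, sq]
      exact mul_le_mul (le_max_right _ _) (le_max_right _ _) (abs_nonneg _) hM.le
    have h4 : max m |x + d| ≤ m + |d| := max_le (by linarith) (by linarith)
    -- The constant is 5 = 2 + 2 + 1: the new potential is at most `2m + 2|d|`, the linear term is
    -- at least `-2|d|`, and the excess `m` is below `|d|`.
    nlinarith

/-! ### Maximal inequality for martingale differences -/

section MaximalInequality

variable {Ω : Type*}

/-- The partial sum `∑_{t < n} D t`. -/
def partialSum (D : ℕ → Ω → ℝ) (n : ℕ) (ω : Ω) : ℝ := ∑ t ∈ Finset.range n, D t ω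

/-- The running maximum `max (1, max_{j ≤ n} |∑_{t < j} D t|)`. -/
def runningMax (D : ℕ → Ω → ℝ) : ℕ → Ω → ℝ
  | 0, _ => 1
  | n + 1, ω => max (runningMax D n ω) |partialSum D (n + 1) ω|

theorem partialSum_succ (D : ℕ → Ω → ℝ) (n : ℕ) (ω : Ω) :
    partialSum D (n + 1) ω = partialSum D n ω + D n ω := by
  simp [partialSum, Finset.sum_range_succ]

theorem one_le_runningMax (D : ℕ → Ω → ℝ) (n : ℕ) (ω : Ω) : 1 ≤ runningMax D n ω := by
  induction n with
  | zero => simp [runningMax]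
  | succ n ih => exact le_max_of_le_left ih

theorem abs_partialSum_le_runningMax (D : ℕ → Ω → ℝ) {j n : ℕ} (h : j ≤ n) (ω : Ω) :
    |partialSum D j ω| ≤ runningMax D n ω := by
  induction n with
  | zero =>
    obtain rfl : j = 0 := by omega
    simp [partialSum, runningMax]
  | succ n ih =>
    rcases h.eq_or_lt with rfl | h
    · exact le_max_right _ _
    · exact le_max_of_le_left (ih (by omega))

theorem measurable_partialSum {𝒢 : ℕ → MeasurableSpace Ω} (hmono : Monotone 𝒢) {D : ℕ → Ω → ℝ}
    (hD : ∀ n, Measurable[𝒢 (n + 1)] (D n)) (n : ℕ) : Measurable[𝒢 n] (partialSum D n) := by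
  have : partialSum D n = fun ω => ∑ t ∈ Finset.range n, D t ω := rfl
  rw [this]
  refine @Finset.measurable_fun_sum _ _ _ _ _ _ (𝒢 n) _ _ fun t ht => ?_
  exact (hD t).mono (hmono (Nat.succ_le_of_lt (Finset.mem_range.1 ht))) le_rfl

theorem measurable_runningMax {𝒢 : ℕ → MeasurableSpace Ω} (hmono : Monotone 𝒢) {D : ℕ → Ω → ℝ}
    (hD : ∀ n, Measurable[𝒢 (n + 1)] (D n)) (n : ℕ) : Measurable[𝒢 n] (runningMax D n) := by
  induction n with
  | zero => exact @measurable_const _ _ _ (𝒢 0) 1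
  | succ n ih =>
    have h1 : Measurable[𝒢 (n + 1)] (runningMax D n) := ih.mono (hmono n.le_succ) le_rfl
    have h2 := measurable_partialSum hmono hD (n + 1)
    let := 𝒢 (n + 1)
    exact h1.max h2.norm

variable [mΩ : MeasurableSpace Ω] {μ : Measure Ω}

theorem integrable_partialSum {D : ℕ → Ω → ℝ} (hint : ∀ n, Integrable (D n) μ) (n : ℕ) :
    Integrable (partialSum D n) μ :=
  integrable_finsetSum _ fun t _ => hint t

theorem integrable_runningMax [IsFiniteMeasure μ] {D : ℕ → Ω → ℝ}
    (hint : ∀ n, Integrable (D n) μ) (n : ℕ) : Integrable (runningMax D n) μ := by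
  induction n with
  | zero => exact integrable_const 1
  | succ n ih => exact ih.sup (integrable_partialSum hint (n + 1)).abs

theorem integral_bounded_mul_eq_zero [IsProbabilityMeasure μ] {m : MeasurableSpace Ω} (hm : m ≤ mΩ)
    {H D : Ω → ℝ} (hH : Measurable[m] H) {c : ℝ} (hc : ∀ ω, |H ω| ≤ c) (hint : Integrable D μ)
    (hz : μ[D | m] =ᵐ[μ] 0) : Integrable (fun ω => H ω * D ω) μ ∧ ∫ ω, H ω * D ω ∂μ = 0 := by
  have hi : Integrable (H * D) μ :=
    hint.bdd_mul (hH.mono hm le_rfl).aestronglyMeasurable (ae_of_all _ hc)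
  refine ⟨hi, ?_⟩
  have h1 := condExp_mul_of_stronglyMeasurable_left (μ := μ) (m := m) hH.stronglyMeasurable hi hint
  have h2 : ∫ ω, (μ[H * D | m]) ω ∂μ = 0 := by
    rw [integral_congr_ae (g := fun _ => (0 : ℝ)) ?_, integral_zero]
    filter_upwards [h1, hz] with ω h1 h2
    simp [h1, h2]
  rwa [integral_condExp hm] at h2

/-- The normalised case: the potential starts at 1, its expectation rises by at most 5 times the
total `q`-th moment, and it dominates the running maximum. This gives 6 = 1 + 5. -/
theorem lintegral_runningMax_le [IsProbabilityMeasure μ] {𝒢 : ℕ → MeasurableSpace Ω}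
    (hle : ∀ n, 𝒢 n ≤ mΩ) (hmono : Monotone 𝒢) {D : ℕ → Ω → ℝ}
    (hD : ∀ n, Measurable[𝒢 (n + 1)] (D n)) (hint : ∀ n, Integrable (D n) μ)
    (hz : ∀ n, μ[D n | 𝒢 n] =ᵐ[μ] 0) {q : ℝ} (hq₁ : 1 ≤ q) (hq₂ : q ≤ 2) (N : ℕ)
    (hB : ∑ t ∈ Finset.range N, ∫⁻ ω, ‖D t ω‖ₑ ^ q ∂μ ≤ 1) :
    ∫ ω, runningMax D N ω ∂μ ≤ 6 := by
  have hpow : ∀ t < N, Integrable (fun ω => |D t ω| ^ q) μ := by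
    intro t ht
    refine ⟨((hint t).1.norm.aemeasurable.pow_const q).aestronglyMeasurable, ?_⟩
    rw [hasFiniteIntegral_iff_enorm]
    have e : ∀ ω, ‖|D t ω| ^ q‖ₑ = ‖D t ω‖ₑ ^ q := fun ω => by
      rw [Real.enorm_eq_ofReal (by positivity), ← ENNReal.ofReal_rpow_of_nonneg (abs_nonneg _)
        (by linarith), Real.enorm_eq_ofReal_abs]
    simp_rw [e]
    exact ((Finset.single_le_sum (f := fun t => ∫⁻ ω, ‖D t ω‖ₑ ^ q ∂μ) (fun _ _ => zero_le)
      (Finset.mem_range.2 ht)).trans hB).trans_lt ENNReal.one_lt_top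
  have hpow' : ∀ t < N, ∫⁻ ω, ‖D t ω‖ₑ ^ q ∂μ = ENNReal.ofReal (∫ ω, |D t ω| ^ q ∂μ) := by
    intro t ht
    rw [ofReal_integral_eq_lintegral_ofReal (hpow t ht) (ae_of_all _ fun ω => by positivity)]
    refine lintegral_congr fun ω => ?_
    rw [← ENNReal.ofReal_rpow_of_nonneg (abs_nonneg _) (by linarith), Real.enorm_eq_ofReal_abs]
  have hB' : ∑ t ∈ Finset.range N, ∫ ω, |D t ω| ^ q ∂μ ≤ 1 := by
    rw [← ENNReal.ofReal_le_one, ENNReal.ofReal_sum_of_nonneg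
      (fun t _ => integral_nonneg fun ω => by positivity)]
    refine le_trans (le_of_eq (Finset.sum_congr rfl fun t ht => ?_)) hB
    rw [hpow' t (Finset.mem_range.1 ht)]
  let Φ : ℕ → Ω → ℝ := fun n ω => runningMax D n ω + partialSum D n ω ^ 2 / runningMax D n ω
  have hSle : ∀ n ω, |partialSum D n ω| ≤ runningMax D n ω := fun n ω =>
    abs_partialSum_le_runningMax D le_rfl ω
  have hpos : ∀ n ω, 0 < runningMax D n ω := fun n ω =>
    zero_lt_one.trans_le (one_le_runningMax D n ω)
  have hΦint : ∀ n, Integrable (Φ n) μ := by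
    intro n
    refine (integrable_runningMax hint n).add ((integrable_runningMax hint n).mono' ?_ ?_)
    · have h1 := (measurable_partialSum hmono hD n).mono (hle n) le_rfl
      have h2 := (measurable_runningMax hmono hD n).mono (hle n) le_rfl
      exact ((h1.pow_const 2).div h2).aestronglyMeasurable
    · refine ae_of_all _ fun ω => ?_
      have := hpos n ω
      rw [Real.norm_eq_abs, abs_of_nonneg (by positivity), div_le_iff₀ this, ← sq_abs, sq]
      exact mul_le_mul (hSle n ω) (hSle n ω) (abs_nonneg _) this.le
  have hstep : ∀ n < N, ∫ ω, Φ (n + 1) ω ∂μ ≤ ∫ ω, Φ n ω ∂μ + 5 * ∫ ω, |D n ω| ^ q ∂μ := by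
    intro n hn
    have h1 := (measurable_partialSum hmono hD n)
    have h2 := (measurable_runningMax hmono hD n)
    -- The ratio is at most 1 in absolute value, so integrability of `D n` alone suffices for the
    -- first-order term to have mean zero.
    have hH : Measurable[𝒢 n] (fun ω => 2 * (partialSum D n ω / runningMax D n ω)) :=
      (h1.div h2).const_mul 2
    obtain ⟨hi, h0⟩ := integral_bounded_mul_eq_zero (hle n) hH (c := 2) (fun ω => by
      rw [abs_mul, abs_div, abs_of_pos (hpos n ω)]
      have : |partialSum D n ω| / runningMax D n ω ≤ 1 :=
        (div_le_one (hpos n ω)).2 (hSle n ω)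
      norm_num; linarith) (hint n) (hz n)
    calc ∫ ω, Φ (n + 1) ω ∂μ
        ≤ ∫ ω, (Φ n ω + 2 * (partialSum D n ω / runningMax D n ω) * D n ω)
            + 5 * |D n ω| ^ q ∂μ := by
          refine integral_mono (hΦint _) (((hΦint n).add hi).add ((hpow n hn).const_mul 5)) ?_
          intro ω
          have := maximal_potential_step (d := D n ω) hq₁ hq₂ (one_le_runningMax D n ω) (hSle n ω)
          simpa only [Φ, runningMax, partialSum_succ] using this
      _ = _ := by
          have h3 : Integrable (fun ω => Φ n ω
              + 2 * (partialSum D n ω / runningMax D n ω) * D n ω) μ := (hΦint n).add hi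
          rw [integral_add h3 ((hpow n hn).const_mul 5), integral_add (hΦint n) hi,
            h0, add_zero, integral_const_mul]
  have hall : ∀ n ≤ N, ∫ ω, Φ n ω ∂μ
      ≤ 1 + 5 * ∑ t ∈ Finset.range n, ∫ ω, |D t ω| ^ q ∂μ := by
    intro n
    induction n with
    | zero => intro _; simp [Φ, runningMax, partialSum]
    | succ n ih =>
      intro hn
      rw [Finset.sum_range_succ]
      linarith [ih (by omega), hstep n (by omega)]
  calc ∫ ω, runningMax D N ω ∂μ ≤ ∫ ω, Φ N ω ∂μ := by
        refine integral_mono (integrable_runningMax hint N) (hΦint N) fun ω => ?_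
        have := hpos N ω
        simp only [Φ]
        have : 0 ≤ partialSum D N ω ^ 2 / runningMax D N ω := by positivity
        linarith
    _ ≤ 6 := by linarith [hall N le_rfl]

/-- A maximal moment inequality for martingale difference sequences with finite moments of order
`q ∈ [1, 2]`. -/
theorem lintegral_sup_partialSum_le [IsProbabilityMeasure μ] {𝒢 : ℕ → MeasurableSpace Ω}
    (hle : ∀ n, 𝒢 n ≤ mΩ) (hmono : Monotone 𝒢) {D : ℕ → Ω → ℝ}
    (hD : ∀ n, Measurable[𝒢 (n + 1)] (D n)) (hint : ∀ n, Integrable (D n) μ)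
    (hz : ∀ n, μ[D n | 𝒢 n] =ᵐ[μ] 0) {q : ℝ} (hq₁ : 1 ≤ q) (hq₂ : q ≤ 2) (N : ℕ)
    {B : ℝ} (hB0 : 0 < B)
    (hB : ∑ t ∈ Finset.range N, ∫⁻ ω, ‖D t ω‖ₑ ^ q ∂μ ≤ ENNReal.ofReal B ^ q) :
    ∫⁻ ω, (Finset.range (N + 1)).sup (fun n => ‖partialSum D n ω‖ₑ) ∂μ
      ≤ 6 * ENNReal.ofReal B := by
  -- The floor 1 in `runningMax` breaks homogeneity; rescaling by `B` restores it.
  let D' : ℕ → Ω → ℝ := fun n ω => B⁻¹ * D n ω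
  have hS : ∀ n ω, partialSum D n ω = B * partialSum D' n ω := by
    intro n ω
    simp only [partialSum, D', ← Finset.mul_sum]
    field_simp
  have hq0 : 0 ≤ q := by linarith
  have hbound : ∑ t ∈ Finset.range N, ∫⁻ ω, ‖D' t ω‖ₑ ^ q ∂μ ≤ 1 := by
    have e : ∀ t, ∫⁻ ω, ‖D' t ω‖ₑ ^ q ∂μ
        = (ENNReal.ofReal B ^ q)⁻¹ * ∫⁻ ω, ‖D t ω‖ₑ ^ q ∂μ := by
      intro t
      rw [← lintegral_const_mul'']
      · refine lintegral_congr fun ω => ?_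
        simp only [D']
        rw [enorm_mul, ENNReal.mul_rpow_of_nonneg _ _ hq0, Real.enorm_eq_ofReal (by positivity),
          ENNReal.ofReal_inv_of_pos hB0, ENNReal.inv_rpow]
      · exact (hint t).1.enorm.pow_const q
    simp_rw [e]
    rw [← Finset.mul_sum]
    calc _ ≤ (ENNReal.ofReal B ^ q)⁻¹ * ENNReal.ofReal B ^ q := by gcongr
      _ ≤ 1 := ENNReal.inv_mul_le_one _
  have hz' : ∀ n, μ[D' n | 𝒢 n] =ᵐ[μ] 0 := by
    intro n
    have h1 := condExp_smul (μ := μ) B⁻¹ (D n) (𝒢 n)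
    have h2 : D' n = B⁻¹ • D n := by ext; simp [D']
    rw [h2]
    filter_upwards [h1, hz n] with ω h1 h2
    rw [h1]
    simp [h2]
  have hint' : ∀ n, Integrable (D' n) μ := fun n => (hint n).const_mul _
  have key := lintegral_runningMax_le hle hmono (D := D') (fun n => (hD n).const_mul B⁻¹)
    hint' hz' hq₁ hq₂ N hbound
  calc ∫⁻ ω, (Finset.range (N + 1)).sup (fun n => ‖partialSum D n ω‖ₑ) ∂μ
      ≤ ∫⁻ ω, ENNReal.ofReal B * ENNReal.ofReal (runningMax D' N ω) ∂μ := by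
        refine lintegral_mono fun ω => Finset.sup_le fun n hn => ?_
        rw [hS, enorm_mul, Real.enorm_eq_ofReal hB0.le, Real.enorm_eq_ofReal_abs]
        gcongr
        exact abs_partialSum_le_runningMax D' (Nat.lt_succ_iff.1 (Finset.mem_range.1 hn)) ω
    _ = ENNReal.ofReal B * ENNReal.ofReal (∫ ω, runningMax D' N ω ∂μ) := by
        rw [lintegral_const_mul' _ _ ENNReal.ofReal_ne_top,
          ofReal_integral_eq_lintegral_ofReal (integrable_runningMax hint' N)
            (ae_of_all _ fun ω => zero_le_one.trans (one_le_runningMax D' N ω))]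
    _ ≤ ENNReal.ofReal B * ENNReal.ofReal 6 := by gcongr
    _ = _ := by rw [mul_comm]; norm_num

end MaximalInequality

/-! ### Integration over independent variables -/

section Freezing

variable {Ω 𝒳 𝒴 : Type*} [mΩ : MeasurableSpace Ω] {μ : Measure Ω} [IsProbabilityMeasure μ]
  [MeasurableSpace 𝒳] [m𝒴 : MeasurableSpace 𝒴] {X : Ω → 𝒳} {Y : Ω → 𝒴}

theorem lintegral_indepFun (hX : Measurable X) (hY : Measurable Y) (h : IndepFun X Y μ)
    {f : 𝒳 → 𝒴 → ℝ≥0∞} (hf : Measurable (Function.uncurry f)) :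
    ∫⁻ ω, f (X ω) (Y ω) ∂μ = ∫⁻ ω, ∫⁻ ω', f (X ω') (Y ω) ∂μ ∂μ := by
  have h1 := (indepFun_iff_map_prod_eq_prod_map_map hX.aemeasurable hY.aemeasurable).1 h
  have := Measure.isProbabilityMeasure_map (μ := μ) hX.aemeasurable
  have := Measure.isProbabilityMeasure_map (μ := μ) hY.aemeasurable
  calc ∫⁻ ω, f (X ω) (Y ω) ∂μ = ∫⁻ z, Function.uncurry f z ∂(μ.map fun ω => (X ω, Y ω)) := by
        rw [lintegral_map hf (hX.prodMk hY)]; rfl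
    _ = ∫⁻ y, ∫⁻ x, f x y ∂(μ.map X) ∂(μ.map Y) := by
        rw [h1, lintegral_prod_symm' _ hf]; rfl
    _ = ∫⁻ ω, ∫⁻ ω', f (X ω') (Y ω) ∂μ ∂μ := by
        rw [lintegral_map (f := fun y => ∫⁻ x, f x y ∂(μ.map X)) hf.lintegral_prod_left' hY]
        refine lintegral_congr fun ω => ?_
        rw [lintegral_map (f := fun x => f x (Y ω)) (hf.comp measurable_prodMk_right) hX]

/-- The conditional expectation of a function of two independent variables, given the second one,
is obtained by integrating out the first one. -/
theorem condExp_indepFun (hX : Measurable X) (hY : Measurable Y) (h : IndepFun X Y μ)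
    {f : 𝒳 → 𝒴 → ℝ} (hf : Measurable (Function.uncurry f))
    (hint : Integrable (fun ω => f (X ω) (Y ω)) μ) :
    (fun ω => ∫ ω', f (X ω') (Y ω) ∂μ) =ᵐ[μ]
      μ[fun ω => f (X ω) (Y ω) | MeasurableSpace.comap Y m𝒴] := by
  have h1 := (indepFun_iff_map_prod_eq_prod_map_map hX.aemeasurable hY.aemeasurable).1 h
  have := Measure.isProbabilityMeasure_map (μ := μ) hX.aemeasurable
  have := Measure.isProbabilityMeasure_map (μ := μ) hY.aemeasurable
  have hfi : Integrable (Function.uncurry f) ((μ.map X).prod (μ.map Y)) := by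
    rw [← h1]
    exact (integrable_map_measure hf.aestronglyMeasurable (hX.prodMk hY).aemeasurable).2 hint
  have hφ : (fun ω => ∫ ω', f (X ω') (Y ω) ∂μ) = (fun y => ∫ x, f x y ∂(μ.map X)) ∘ Y := by
    ext ω
    simp only [Function.comp]
    rw [integral_map hX.aemeasurable]
    exact (hf.comp measurable_prodMk_right).aestronglyMeasurable
  have hφm : StronglyMeasurable (fun y => ∫ x, f x y ∂(μ.map X)) :=
    hf.stronglyMeasurable.integral_prod_left
  have hφi : Integrable (fun y => ∫ x, f x y ∂(μ.map X)) (μ.map Y) := hfi.integral_prod_right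
  rw [hφ]
  refine ae_eq_condExp_of_forall_setIntegral_eq hY.comap_le hint (fun s _ _ => ?_)
    (fun s hs _ => ?_) ?_
  · exact (hφi.comp_measurable hY).integrableOn
  · obtain ⟨B, hB, rfl⟩ := hs
    have e1 : ∫ ω in Y ⁻¹' B, ((fun y => ∫ x, f x y ∂(μ.map X)) ∘ Y) ω ∂μ
        = ∫ y in B, ∫ x, f x y ∂(μ.map X) ∂(μ.map Y) := by
      rw [setIntegral_map hB hφm.aestronglyMeasurable hY.aemeasurable]; rfl
    have e2 : ∫ ω in Y ⁻¹' B, f (X ω) (Y ω) ∂μ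
        = ∫ z in Set.univ ×ˢ B, Function.uncurry f z ∂((μ.map X).prod (μ.map Y)) := by
      rw [← h1, setIntegral_map (MeasurableSet.univ.prod hB) hf.aestronglyMeasurable
        (hX.prodMk hY).aemeasurable]
      congr 2
      ext ω; simp
    rw [e1, e2, ← Measure.prod_restrict, Measure.restrict_univ]
    have hfi' : Integrable (Function.uncurry f) ((μ.map X).prod ((μ.map Y).restrict B)) := by
      have := hfi.integrableOn (s := Set.univ ×ˢ B)
      rwa [IntegrableOn, ← Measure.prod_restrict, Measure.restrict_univ] at this
    rw [integral_prod_symm _ hfi']; rfl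
  · exact (hφm.comp_measurable (comap_measurable Y)).aestronglyMeasurable

theorem ae_integrable_indepFun (hX : Measurable X) (hY : Measurable Y) (h : IndepFun X Y μ)
    {f : 𝒳 → 𝒴 → ℝ} (hf : Measurable (Function.uncurry f))
    (hint : Integrable (fun ω => f (X ω) (Y ω)) μ) :
    ∀ᵐ ω ∂μ, Integrable (fun ω' => f (X ω') (Y ω)) μ := by
  have h1 := (indepFun_iff_map_prod_eq_prod_map_map hX.aemeasurable hY.aemeasurable).1 h
  have := Measure.isProbabilityMeasure_map (μ := μ) hX.aemeasurable
  have := Measure.isProbabilityMeasure_map (μ := μ) hY.aemeasurable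
  have hfi : Integrable (Function.uncurry f) ((μ.map X).prod (μ.map Y)) := by
    rw [← h1]
    exact (integrable_map_measure hf.aestronglyMeasurable (hX.prodMk hY).aemeasurable).2 hint
  filter_upwards [ae_of_ae_map hY.aemeasurable hfi.prod_left_ae] with ω hω
  exact hω.comp_measurable hX

/-- Both sides integrate `H` against the product of the three marginal laws. Only `X` must be
independent of `Y` and of `Z`: the draws of `Y` and `Z` come from different copies. This matters
because in the application `Y` is a coordinate of `Z`. -/
theorem lintegral_lintegral_indepFun {𝒵 : Type*} [MeasurableSpace 𝒵] {Z : Ω → 𝒵}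
    (hX : Measurable X) (hY : Measurable Y) (hZ : Measurable Z) (hXY : IndepFun X Y μ)
    (hXZ : IndepFun X Z μ) {H : 𝒳 → 𝒴 → 𝒵 → ℝ≥0∞}
    (hH : Measurable fun z : 𝒳 × 𝒴 × 𝒵 => H z.1 z.2.1 z.2.2) :
    ∫⁻ ω, ∫⁻ ω', H (X ω') (Y ω') (Z ω) ∂μ ∂μ
      = ∫⁻ w : Ω × Ω, H (X w.1) (Y w.2) (Z w.1) ∂(μ.prod μ) := by
  calc _ = ∫⁻ ω, ∫⁻ w₂, ∫⁻ w, H (X w) (Y w₂) (Z ω) ∂μ ∂μ ∂μ := by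
        refine lintegral_congr fun ω => ?_
        refine lintegral_indepFun hX hY hXY (f := fun a b => H a b (Z ω)) ?_
        exact hH.comp (measurable_fst.prodMk (measurable_snd.prodMk measurable_const))
    _ = ∫⁻ w₂, ∫⁻ ω, ∫⁻ w, H (X w) (Y w₂) (Z ω) ∂μ ∂μ ∂μ := by
        refine lintegral_lintegral_swap (Measurable.aemeasurable ?_)
        have mK : Measurable fun z : (Ω × Ω) × Ω => H (X z.2) (Y z.1.2) (Z z.1.1) :=
          hH.comp ((hX.comp measurable_snd).prodMk
            ((hY.comp (measurable_snd.comp measurable_fst)).prodMk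
              (hZ.comp (measurable_fst.comp measurable_fst))))
        exact mK.lintegral_prod_right'
    _ = ∫⁻ w₂, ∫⁻ w₁, H (X w₁) (Y w₂) (Z w₁) ∂μ ∂μ := by
        refine lintegral_congr fun w₂ => ?_
        refine (lintegral_indepFun hX hZ hXZ (f := fun a u => H a (Y w₂) u) ?_).symm
        exact hH.comp (measurable_fst.prodMk (measurable_const.prodMk measurable_snd))
    _ = _ := by
        have mK : Measurable fun w : Ω × Ω => H (X w.1) (Y w.2) (Z w.1) :=
          hH.comp ((hX.comp measurable_fst).prodMk
            ((hY.comp measurable_snd).prodMk (hZ.comp measurable_fst)))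
        exact (lintegral_prod_symm' _ mK).symm

end Freezing

/-! ### Innovations, their past σ-algebras, and the projection bound -/

section Innovations

variable {Ω E : Type*} [mΩ : MeasurableSpace Ω] [mE : MeasurableSpace E] {μ : Measure Ω}
  {ε : ℤ → Ω → E}

/-- The innovations up to time `s`, most recent first. -/
def pastSeq (ε : ℤ → Ω → E) (s : ℤ) (ω : Ω) (j : ℕ) : E := ε (s - j) ω

/-- The `m` innovations up to time `t`, most recent first. -/
def recent (ε : ℤ → Ω → E) (t : ℤ) (m : ℕ) (ω : Ω) (j : Fin m) : E := ε (t - (j : ℕ)) ω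

/-- The σ-algebra generated by the innovations up to time `s`. -/
@[reducible] def pastσ (ε : ℤ → Ω → E) (s : ℤ) : MeasurableSpace Ω :=
  MeasurableSpace.comap (pastSeq ε s) MeasurableSpace.pi

/-- Concatenation of a finite tuple and a sequence. -/
def glue (m : ℕ) (a : Fin m → E) (r : ℕ → E) (j : ℕ) : E :=
  if h : j < m then a ⟨j, h⟩ else r (j - m)

/-- The sequence with first entry `e` followed by `r`. -/
def seqCons (e : E) (r : ℕ → E) : ℕ → E
  | 0 => e
  | j + 1 => r j

theorem measurable_glue (m : ℕ) :
    Measurable fun z : (Fin m → E) × (ℕ → E) => glue m z.1 z.2 := by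
  refine measurable_pi_lambda _ fun j => ?_
  by_cases h : j < m
  · simp only [glue, h, dite_true]; fun_prop
  · simp only [glue, h, dite_false]; fun_prop

theorem measurable_seqCons : Measurable fun z : E × (ℕ → E) => seqCons z.1 z.2 := by
  refine measurable_pi_lambda _ fun j => ?_
  cases j with
  | zero => exact measurable_fst
  | succ j => exact (measurable_pi_apply j).comp measurable_snd

theorem measurable_pastSeq (hε : ∀ s, Measurable (ε s)) (s : ℤ) : Measurable (pastSeq ε s) :=
  measurable_pi_lambda _ fun _ => hε _

theorem measurable_recent (hε : ∀ s, Measurable (ε s)) (t : ℤ) (m : ℕ) :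
    Measurable (recent ε t m) :=
  measurable_pi_lambda _ fun _ => hε _

theorem pastσ_le (hε : ∀ s, Measurable (ε s)) (s : ℤ) : pastσ ε s ≤ mΩ :=
  (measurable_pastSeq hε s).comap_le

omit mΩ in
theorem pastσ_mono : Monotone (pastσ ε) := by
  intro s s' h
  have e : pastSeq ε s = (fun r : ℕ → E => fun j => r (j + (s' - s).toNat)) ∘ pastSeq ε s' := by
    ext ω j
    simp only [pastSeq, Function.comp]
    congr 1
    push_cast
    rw [Int.toNat_of_nonneg (by omega)]; ring
  rw [pastσ, e, ← MeasurableSpace.comap_comp]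
  refine MeasurableSpace.comap_mono (Measurable.comap_le ?_)
  exact measurable_pi_lambda _ fun j => measurable_pi_apply _

omit mΩ mE in
theorem glue_recent_pastSeq (t : ℤ) (m : ℕ) (ω : Ω) :
    glue m (recent ε t m ω) (pastSeq ε (t - m) ω) = pastSeq ε t ω := by
  ext j
  simp only [glue, recent, pastSeq]
  split_ifs with h
  · rfl
  · congr 1
    rw [Nat.cast_sub (by omega)]; ring

omit mΩ mE in
theorem seqCons_pastSeq (s : ℤ) (ω : Ω) :
    seqCons (ε s ω) (pastSeq ε (s - 1) ω) = pastSeq ε s ω := by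
  ext j
  cases j with
  | zero => simp [seqCons, pastSeq]
  | succ j =>
    simp only [seqCons, pastSeq]
    congr 1
    push_cast; ring

omit mΩ mE in
theorem glue_recent_seqCons (t : ℤ) (m : ℕ) (ω ω' : Ω) :
    glue m (recent ε t m ω) (seqCons (ε (t - m) ω') (pastSeq ε (t - m - 1) ω))
      = fun j : ℕ => if j = m then ε (t - j) ω' else ε (t - j) ω := by
  ext j
  simp only [glue, recent]
  split_ifs with h h' h'
  · omega
  · rfl
  · subst h'; simp [seqCons]
  · obtain ⟨l, rfl⟩ : ∃ l, j = m + l + 1 := ⟨j - m - 1, by omega⟩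
    rw [show m + l + 1 - m = l + 1 by omega]
    simp only [seqCons, pastSeq]
    congr 1
    push_cast; ring

omit mΩ in
theorem comap_reindex_le {γ : Type*} (c : γ → ℤ) :
    MeasurableSpace.comap (fun ω i => ε (c i) ω) (MeasurableSpace.pi (X := fun _ : γ => E)) ≤
      ⨆ s ∈ Set.range c, MeasurableSpace.comap (ε s) mE := by
  rw [MeasurableSpace.pi, MeasurableSpace.comap_iSup]
  refine iSup_le fun i => ?_
  rw [MeasurableSpace.comap_comp]
  exact le_iSup₂_of_le (c i) ⟨i, rfl⟩ le_rfl

theorem indepFun_reindex (hε : ∀ s, Measurable (ε s)) (h : iIndepFun ε μ) {α β : Type*}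
    (a : α → ℤ) (b : β → ℤ) (hab : Disjoint (Set.range a) (Set.range b)) :
    IndepFun (fun ω i => ε (a i) ω) (fun ω j => ε (b j) ω) μ := by
  have h1 := indep_iSup_of_disjoint (fun s => (hε s).comap_le) h.iIndep hab
  rw [IndepFun_iff_Indep]
  exact indep_of_indep_of_le_left (indep_of_indep_of_le_right h1 (comap_reindex_le b))
    (comap_reindex_le a)

theorem indepFun_recent_pastSeq (hε : ∀ s, Measurable (ε s)) (h : iIndepFun ε μ) (t : ℤ) (m : ℕ) :
    IndepFun (recent ε t m) (pastSeq ε (t - m)) μ := by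
  refine indepFun_reindex hε h (fun j : Fin m => t - (j : ℕ)) (fun j : ℕ => t - m - j) ?_
  rw [Set.disjoint_left]
  rintro _ ⟨i, rfl⟩ ⟨j, hj⟩
  have := i.2
  simp only at hj
  omega

theorem indepFun_recent_innov (hε : ∀ s, Measurable (ε s)) (h : iIndepFun ε μ) (t : ℤ) (m : ℕ) :
    IndepFun (recent ε t m) (ε (t - m)) μ := by
  have h1 := (indepFun_recent_pastSeq hε h t m).comp measurable_id (measurable_pi_apply 0)
  have e : (fun r : ℕ → E => r 0) ∘ pastSeq ε (t - m) = ε (t - m) := by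
    ext ω; simp [pastSeq]
  rwa [e] at h1

/-- The pair is a function of the `m + 1` most recent innovations. -/
theorem indepFun_recent_prod_pastSeq (hε : ∀ s, Measurable (ε s)) (h : iIndepFun ε μ) (t : ℤ)
    (m : ℕ) :
    IndepFun (fun ω => (recent ε t m ω, ε (t - m) ω)) (pastSeq ε (t - m - 1)) μ := by
  have h1 : IndepFun (recent ε t (m + 1)) (pastSeq ε (t - m - 1)) μ := by
    have := indepFun_recent_pastSeq hε h t (m + 1)
    rwa [show t - ((m + 1 : ℕ) : ℤ) = t - m - 1 by push_cast; ring] at this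
  have hφ : Measurable fun a : Fin (m + 1) → E =>
      ((fun i : Fin m => a i.castSucc), a (Fin.last m)) := by fun_prop
  exact h1.comp hφ measurable_id

variable [IsProbabilityMeasure μ]

theorem enorm_integral_rpow_le {Ω' : Type*} [MeasurableSpace Ω'] {P : Measure Ω'}
    [IsProbabilityMeasure P] {f : Ω' → ℝ} (hf : AEStronglyMeasurable f P) {q : ℝ} (hq : 1 ≤ q) :
    ‖∫ ω, f ω ∂P‖ₑ ^ q ≤ ∫⁻ ω, ‖f ω‖ₑ ^ q ∂P := by
  have hq0 : 0 < q := by linarith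
  have h1 : ‖∫ ω, f ω ∂P‖ₑ ≤ eLpNorm f (ENNReal.ofReal q) P := by
    calc ‖∫ ω, f ω ∂P‖ₑ ≤ ∫⁻ ω, ‖f ω‖ₑ ∂P := enorm_integral_le_lintegral_enorm _
      _ = eLpNorm f 1 P := eLpNorm_one_eq_lintegral_enorm.symm
      _ ≤ _ := eLpNorm_le_eLpNorm_of_exponent_le (ENNReal.one_le_ofReal.2 hq) hf
  rw [eLpNorm_eq_lintegral_rpow_enorm_toReal (by simpa using hq0) ENNReal.ofReal_ne_top,
    ENNReal.toReal_ofReal hq0.le, one_div] at h1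
  calc _ ≤ ((∫⁻ ω, ‖f ω‖ₑ ^ q ∂P) ^ q⁻¹) ^ q := by gcongr
    _ = _ := ENNReal.rpow_inv_rpow hq0.ne' _

/-- The projections `E[x | G_{t-m}] - E[x | G_{t-m-1}]` of a causal variable are dominated by its
physical dependence measure. -/
theorem lintegral_projection_le (hε : ∀ s, Measurable (ε s)) (hind : iIndepFun ε μ)
    {h : (ℕ → E) → ℝ} (hh : Measurable h) (t : ℤ) (m : ℕ)
    (hint : Integrable (fun ω => h (pastSeq ε t ω)) μ) {q : ℝ} (hq : 1 ≤ q) :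
    ∫⁻ ω, ‖(μ[fun ω => h (pastSeq ε t ω) | pastσ ε (t - m)]) ω
        - (μ[fun ω => h (pastSeq ε t ω) | pastσ ε (t - m - 1)]) ω‖ₑ ^ q ∂μ
      ≤ ∫⁻ w, ‖h (pastSeq ε t w.1)
        - h (fun j : ℕ => if j = m then ε (t - j) w.2 else ε (t - j) w.1)‖ₑ ^ q ∂(μ.prod μ) := by
  set A := recent ε t m with hA
  set e := ε (t - m) with he
  set U := pastSeq ε (t - m) with hU
  set R := pastSeq ε (t - m - 1) with hR
  have mA : Measurable A := measurable_recent hε t m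
  have me : Measurable e := hε _
  have mU : Measurable U := measurable_pastSeq hε _
  have mR : Measurable R := measurable_pastSeq hε _
  let f₁ : (Fin m → E) → (ℕ → E) → ℝ := fun a u => h (glue m a u)
  let f₂ : (Fin m → E) × E → (ℕ → E) → ℝ := fun z r => h (glue m z.1 (seqCons z.2 r))
  have mf₁ : Measurable (Function.uncurry f₁) := hh.comp (measurable_glue m)
  have mf₂ : Measurable (Function.uncurry f₂) := by
    have h1 : Measurable fun z : ((Fin m → E) × E) × (ℕ → E) => seqCons z.1.2 z.2 :=
      measurable_seqCons.comp ((measurable_snd.comp measurable_fst).prodMk measurable_snd)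
    exact hh.comp ((measurable_glue m).comp ((measurable_fst.comp measurable_fst).prodMk h1))
  have ef₁ : ∀ ω, f₁ (A ω) (U ω) = h (pastSeq ε t ω) := fun ω => by
    simp only [f₁, hA, hU, glue_recent_pastSeq]
  have eU : ∀ ω, seqCons (e ω) (R ω) = U ω := fun ω => seqCons_pastSeq _ _
  have ef₂ : ∀ ω, f₂ (A ω, e ω) (R ω) = h (pastSeq ε t ω) := fun ω => by
    simp only [f₂, eU]; exact ef₁ ω
  have c₁ := condExp_indepFun (μ := μ) mA mU (indepFun_recent_pastSeq hε hind t m) mf₁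
    (by simpa only [ef₁] using hint)
  have c₂ := condExp_indepFun (μ := μ) (mA.prodMk me) mR (indepFun_recent_prod_pastSeq hε hind t m)
    mf₂ (by simpa only [ef₂] using hint)
  simp only [ef₁] at c₁
  simp only [ef₂] at c₂
  -- `H` compares the causal variable built from the recent block `a` and past `u` with the one
  -- where the newest entry of `u`, the innovation at time `t - m`, is replaced by `e'`.
  let H : (Fin m → E) → E → (ℕ → E) → ℝ≥0∞ := fun a e' u =>
    ‖h (glue m a u) - h (glue m a (seqCons e' fun j => u (j + 1)))‖ₑ ^ q
  have mH : Measurable fun z : (Fin m → E) × E × (ℕ → E) => H z.1 z.2.1 z.2.2 := by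
    have h1 : Measurable fun z : (Fin m → E) × E × (ℕ → E) => h (glue m z.1 z.2.2) :=
      hh.comp ((measurable_glue m).comp
        (measurable_fst.prodMk (measurable_snd.comp measurable_snd)))
    have h0 : Measurable fun u : ℕ → E => fun j => u (j + 1) :=
      measurable_pi_lambda _ fun j => measurable_pi_apply (j + 1)
    have h2 : Measurable fun z : (Fin m → E) × E × (ℕ → E) =>
        seqCons z.2.1 fun j => z.2.2 (j + 1) :=
      measurable_seqCons.comp ((measurable_fst.comp measurable_snd).prodMk
        (h0.comp (measurable_snd.comp measurable_snd)))
    have h3 : Measurable fun z : (Fin m → E) × E × (ℕ → E) =>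
        h (glue m z.1 (seqCons z.2.1 fun j => z.2.2 (j + 1))) :=
      hh.comp ((measurable_glue m).comp (measurable_fst.prodMk h2))
    exact (h1.sub h3).enorm.pow_const q
  have eR : ∀ ω, (fun j => U ω (j + 1)) = R ω := fun ω => by
    rw [← eU]; rfl
  calc _ ≤ ∫⁻ ω, ∫⁻ ω', H (A ω') (e ω') (U ω) ∂μ ∂μ := by
        have i₁ : ∀ᵐ ω ∂μ, Integrable (fun ω' => f₁ (A ω') (U ω)) μ :=
          ae_integrable_indepFun mA mU (indepFun_recent_pastSeq hε hind t m) mf₁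
            (by simpa only [ef₁] using hint)
        have i₂ : ∀ᵐ ω ∂μ, Integrable (fun ω' => f₂ (A ω', e ω') (R ω)) μ :=
          ae_integrable_indepFun (mA.prodMk me) mR (indepFun_recent_prod_pastSeq hε hind t m) mf₂
            (by simpa only [ef₂] using hint)
        refine lintegral_mono_ae ?_
        filter_upwards [c₁, c₂, i₁, i₂] with ω h₁ h₂ i₁ i₂
        simp only [pastσ]
        -- Both conditional expectations integrate over the same copy `ω'` of the recent block, so
        -- their difference is a single integral to which Jensen's inequality applies.
        rw [← h₁, ← h₂, ← integral_sub i₁ i₂]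
        refine (enorm_integral_rpow_le (i₁.sub i₂).1 hq).trans (le_of_eq ?_)
        simp only [H, f₁, f₂, eR]; rfl
    _ = ∫⁻ w : Ω × Ω, H (A w.1) (e w.2) (U w.1) ∂(μ.prod μ) :=
        lintegral_lintegral_indepFun mA me mU (indepFun_recent_innov hε hind t m)
          (indepFun_recent_pastSeq hε hind t m) mH
    _ = _ := by
        refine lintegral_congr fun w => ?_
        simp only [H, eR]
        rw [hA, hR, he, glue_recent_seqCons, hU, glue_recent_pastSeq]

end Innovations

/-! ### Decomposition into projections and the maximal inequality for one series -/

section Projections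

variable {Ω E : Type*} [mΩ : MeasurableSpace Ω] [mE : MeasurableSpace E] {μ : Measure Ω}
  [IsProbabilityMeasure μ] {ε : ℤ → Ω → E}

/-- The filtration generated by the `m` innovations up to time `t`. -/
def recentFiltration (hε : ∀ s, Measurable (ε s)) (t : ℤ) : Filtration ℕ mΩ where
  seq m := MeasurableSpace.comap (recent ε t m) MeasurableSpace.pi
  mono' := by
    intro m n h
    have e : recent ε t m = (fun (a : Fin n → E) (j : Fin m) => a (Fin.castLE h j)) ∘
        recent ε t n := rfl
    simp only
    rw [e, ← MeasurableSpace.comap_comp]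
    refine MeasurableSpace.comap_mono (Measurable.comap_le ?_)
    exact measurable_pi_lambda _ fun j => measurable_pi_apply _
  le' m := (measurable_recent hε t m).comap_le

theorem measurable_finset_sup {Ω ι : Type*} [MeasurableSpace Ω] [Countable ι] (s : Finset ι)
    {f : ι → Ω → ℝ≥0∞} (hf : ∀ i ∈ s, Measurable (f i)) :
    Measurable fun ω => s.sup fun i => f i ω := by
  simp_rw [Finset.sup_eq_iSup]
  exact Measurable.iSup fun i => Measurable.iSup fun hi => hf i hi

theorem measurable_pastSeq_iSup (hε : ∀ s, Measurable (ε s)) (t : ℤ) :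
    Measurable[⨆ m, recentFiltration hε t m] (pastSeq ε t) := by
  refine @measurable_pi_lambda _ _ _ (⨆ m, recentFiltration hε t m) _ _ fun j => ?_
  have h1 : Measurable[recentFiltration hε t (j + 1)] (recent ε t (j + 1)) :=
    comap_measurable _
  have h2 : Measurable[recentFiltration hε t (j + 1)] (fun ω => recent ε t (j + 1) ω (Fin.last j)) :=
    (measurable_pi_apply (Fin.last j)).comp h1
  exact h2.mono (le_iSup (fun m => recentFiltration hε t m) (j + 1)) le_rfl

/-- The approximation of `x` by its `m` most recent innovations is centered and independent of the
older past, so conditioning on that past kills it; only the approximation error survives, and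
conditioning contracts `L¹`. The remote past is thus handled by Lévy's upward theorem along
`recentFiltration`. -/
theorem eLpNorm_condExp_pastσ_le (hε : ∀ s, Measurable (ε s)) (hind : iIndepFun ε μ) {x : Ω → ℝ}
    (hint : Integrable x μ) (hmean : ∫ ω, x ω ∂μ = 0) (t : ℤ) (m : ℕ) :
    eLpNorm (μ[x | pastσ ε (t - m)]) 1 μ ≤ eLpNorm (μ[x | recentFiltration hε t m] - x) 1 μ := by
  have hle := (recentFiltration hε t).le m
  have h0 : μ[μ[x | recentFiltration hε t m] | pastσ ε (t - m)] =ᵐ[μ] fun _ => (0 : ℝ) := by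
    have := condExp_indep_eq (μ := μ) hle (pastσ_le hε (t - m))
      (stronglyMeasurable_condExp (μ := μ) (f := x)) ((IndepFun_iff_Indep _ _ _).1
        (indepFun_recent_pastSeq hε hind t m))
    rwa [integral_condExp hle, hmean] at this
  have h1 := condExp_sub (μ := μ) (integrable_condExp (f := x) (m := recentFiltration hε t m))
    hint (pastσ ε (t - m))
  calc eLpNorm (μ[x | pastσ ε (t - m)]) 1 μ
      = eLpNorm (μ[μ[x | recentFiltration hε t m] - x | pastσ ε (t - m)]) 1 μ := by
        rw [← eLpNorm_neg]
        refine eLpNorm_congr_ae ?_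
        filter_upwards [h0, h1] with ω h0 h1
        rw [h1]
        simp [h0]
    _ ≤ _ := eLpNorm_condExp_le_eLpNorm _ le_rfl

/-- The remote past of an independent sequence carries no information about a centered causal
variable. -/
theorem tendsto_lintegral_condExp_pastσ (hε : ∀ s, Measurable (ε s)) (hind : iIndepFun ε μ)
    {h : (ℕ → E) → ℝ} (hh : Measurable h) (t : ℤ)
    (hint : Integrable (fun ω => h (pastSeq ε t ω)) μ)
    (hmean : ∫ ω, h (pastSeq ε t ω) ∂μ = 0) :
    Tendsto (fun m : ℕ => ∫⁻ ω, ‖(μ[fun ω => h (pastSeq ε t ω) | pastσ ε (t - m)]) ω‖ₑ ∂μ)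
      atTop (𝓝 0) := by
  have hm : StronglyMeasurable[⨆ m, recentFiltration hε t m] (fun ω => h (pastSeq ε t ω)) :=
    (hh.comp (measurable_pastSeq_iSup hε t)).stronglyMeasurable
  refine tendsto_of_tendsto_of_tendsto_of_le_of_le tendsto_const_nhds
    (hint.tendsto_eLpNorm_condExp hm) (fun _ => zero_le) fun m => ?_
  simp only
  rw [← eLpNorm_one_eq_lintegral_enorm]
  exact eLpNorm_condExp_pastσ_le hε hind hint hmean t m

/-- The projection `E[x | G_{t-m}] - E[x | G_{t-m-1}]`. -/
noncomputable def projection (μ : Measure Ω) (ε : ℤ → Ω → E) (x : Ω → ℝ) (t : ℤ) (m : ℕ) (ω : Ω) : ℝ :=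
  (μ[x | pastσ ε (t - m)]) ω - (μ[x | pastσ ε (t - m - 1)]) ω

omit [IsProbabilityMeasure μ] in
theorem sum_projection (x : Ω → ℝ) (t : ℤ) (M : ℕ) (ω : Ω) :
    ∑ m ∈ Finset.range M, projection μ ε x t m ω
      = (μ[x | pastσ ε t]) ω - (μ[x | pastσ ε (t - M)]) ω := by
  induction M with
  | zero => simp
  | succ M ih =>
    rw [Finset.sum_range_succ, ih, projection]
    rw [show t - ((M + 1 : ℕ) : ℤ) = t - M - 1 by push_cast; ring]
    ring

theorem lintegral_sup_partialSum_projection_le (hε : ∀ s, Measurable (ε s)) (x : ℕ → Ω → ℝ)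
    {q : ℝ} (hq₁ : 1 ≤ q) (hq₂ : q ≤ 2) (N m : ℕ) {B : ℝ} (hB0 : 0 < B)
    (hB : ∑ n ∈ Finset.range N, ∫⁻ ω, ‖projection μ ε (x n) ((n + 1 : ℕ) : ℤ) m ω‖ₑ ^ q ∂μ
      ≤ ENNReal.ofReal B ^ q) :
    ∫⁻ ω, (Finset.range (N + 1)).sup (fun n =>
      ‖partialSum (fun n => projection μ ε (x n) ((n + 1 : ℕ) : ℤ) m) n ω‖ₑ) ∂μ
      ≤ 6 * ENNReal.ofReal B := by
  -- Index `n` stands for time `n + 1`, so step `n` of the filtration is the past of time `n - m`,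
  -- and the lag-`m` projection at time `n + 1` becomes measurable exactly one step later.
  refine lintegral_sup_partialSum_le (𝒢 := fun n => pastσ ε (((n + 1 : ℕ) : ℤ) - m - 1))
    (fun n => pastσ_le hε _) (fun a b hab => pastσ_mono (by push_cast; omega))
    (fun n => ?_) (fun n => integrable_condExp.sub integrable_condExp) (fun n => ?_)
    hq₁ hq₂ N hB0 hB
  · have h1 : Measurable[pastσ ε (((n + 1 + 1 : ℕ) : ℤ) - m - 1)]
        (μ[x n | pastσ ε (((n + 1 : ℕ) : ℤ) - m)]) :=
      stronglyMeasurable_condExp.measurable.mono (pastσ_mono (by push_cast; omega)) le_rfl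
    have h2 : Measurable[pastσ ε (((n + 1 + 1 : ℕ) : ℤ) - m - 1)]
        (μ[x n | pastσ ε (((n + 1 : ℕ) : ℤ) - m - 1)]) :=
      stronglyMeasurable_condExp.measurable.mono (pastσ_mono (by push_cast; omega)) le_rfl
    exact h1.sub h2
  · have h1 := condExp_sub (μ := μ)
      (integrable_condExp (f := x n) (m := pastσ ε (((n + 1 : ℕ) : ℤ) - m)))
      (integrable_condExp (f := x n) (m := pastσ ε (((n + 1 : ℕ) : ℤ) - m - 1)))
      (pastσ ε (((n + 1 : ℕ) : ℤ) - m - 1))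
    have h2 := condExp_condExp_of_le (μ := μ) (f := x n)
      (pastσ_mono (ε := ε) (show ((n + 1 : ℕ) : ℤ) - m - 1 ≤ ((n + 1 : ℕ) : ℤ) - m by omega))
      (pastσ_le hε _)
    have h3 := condExp_of_stronglyMeasurable (μ := μ) (pastσ_le hε _)
      (stronglyMeasurable_condExp (f := x n) (m := pastσ ε (((n + 1 : ℕ) : ℤ) - m - 1)))
      integrable_condExp
    refine EventuallyEq.trans h1 ?_
    rw [h3]
    filter_upwards [h2] with ω h2
    rw [Pi.sub_apply, h2, sub_self, Pi.zero_apply]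

/-- A maximal inequality for partial sums of centered causal variables, in terms of the physical
dependence measure of order `q ∈ [1, 2]`. -/
theorem lintegral_sup_causal_le (hε : ∀ s, Measurable (ε s)) (hind : iIndepFun ε μ)
    {h : ℕ → (ℕ → E) → ℝ} (hh : ∀ n, Measurable (h n))
    (hint : ∀ n, Integrable (fun ω => h n (pastSeq ε ((n + 1 : ℕ) : ℤ) ω)) μ)
    (hmean : ∀ n, ∫ ω, h n (pastSeq ε ((n + 1 : ℕ) : ℤ) ω) ∂μ = 0)
    {q : ℝ} (hq₁ : 1 ≤ q) (hq₂ : q ≤ 2) (N : ℕ) {B : ℕ → ℝ} (hB0 : ∀ m, 0 < B m)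
    (hB : ∀ m, ∑ n ∈ Finset.range N, ∫⁻ w, ‖h n (pastSeq ε ((n + 1 : ℕ) : ℤ) w.1)
        - h n (fun j : ℕ => if j = m then ε (((n + 1 : ℕ) : ℤ) - j) w.2
          else ε (((n + 1 : ℕ) : ℤ) - j) w.1)‖ₑ ^ q ∂(μ.prod μ)
      ≤ ENNReal.ofReal (B m) ^ q) :
    ∫⁻ ω, (Finset.range (N + 1)).sup (fun n =>
      ‖∑ t ∈ Finset.range n, h t (pastSeq ε ((t + 1 : ℕ) : ℤ) ω)‖ₑ) ∂μ
      ≤ ∑' m, 6 * ENNReal.ofReal (B m) := by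
  set x : ℕ → Ω → ℝ := fun n ω => h n (pastSeq ε ((n + 1 : ℕ) : ℤ) ω) with hx
  have hxc : ∀ n, μ[x n | pastσ ε ((n + 1 : ℕ) : ℤ)] = x n := fun n =>
    condExp_of_stronglyMeasurable (pastσ_le hε _)
      ((hh n).comp (comap_measurable _)).stronglyMeasurable (hint n)
  have hdec : ∀ M n ω, x n ω = ∑ m ∈ Finset.range M, projection μ ε (x n) ((n + 1 : ℕ) : ℤ) m ω
      + (μ[x n | pastσ ε (((n + 1 : ℕ) : ℤ) - M)]) ω := by
    intro M n ω
    rw [sum_projection, hxc]; ring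
  let S : ℕ → Ω → ℝ≥0∞ := fun m ω => (Finset.range (N + 1)).sup fun n =>
    ‖partialSum (fun n => projection μ ε (x n) ((n + 1 : ℕ) : ℤ) m) n ω‖ₑ
  let T : ℕ → Ω → ℝ≥0∞ := fun M ω => ∑ n ∈ Finset.range N,
    ‖(μ[x n | pastσ ε (((n + 1 : ℕ) : ℤ) - M)]) ω‖ₑ
  have hcm : ∀ n s, Measurable (μ[x n | pastσ ε s]) := fun n s =>
    stronglyMeasurable_condExp.measurable.mono (pastσ_le hε s) le_rfl
  have hSm : ∀ m, Measurable (S m) := by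
    intro m
    refine measurable_finset_sup _ fun n _ => Measurable.enorm ?_
    exact Finset.measurable_fun_sum _ fun t _ => (hcm _ _).sub (hcm _ _)
  have hpt : ∀ M ω, (Finset.range (N + 1)).sup (fun n => ‖∑ t ∈ Finset.range n, x t ω‖ₑ)
      ≤ ∑ m ∈ Finset.range M, S m ω + T M ω := by
    intro M ω
    refine Finset.sup_le fun n hn => ?_
    have e : ∑ t ∈ Finset.range n, x t ω = ∑ m ∈ Finset.range M,
        partialSum (fun n => projection μ ε (x n) ((n + 1 : ℕ) : ℤ) m) n ω
        + ∑ t ∈ Finset.range n, (μ[x t | pastσ ε (((t + 1 : ℕ) : ℤ) - M)]) ω := by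
      simp only [partialSum]
      rw [Finset.sum_comm, ← Finset.sum_add_distrib]
      exact Finset.sum_congr rfl fun t _ => hdec M t ω
    rw [e]
    refine (enorm_add_le _ _).trans (add_le_add ?_ ?_)
    · refine (enorm_sum_le _ _).trans (Finset.sum_le_sum fun m _ => ?_)
      exact Finset.le_sup (f := fun n =>
        ‖partialSum (fun n => projection μ ε (x n) ((n + 1 : ℕ) : ℤ) m) n ω‖ₑ) hn
    · refine (enorm_sum_le _ _).trans (Finset.sum_le_sum_of_subset ?_)
      intro a ha
      simp only [Finset.mem_range] at *
      omega
  have hS : ∀ m, ∫⁻ ω, S m ω ∂μ ≤ 6 * ENNReal.ofReal (B m) := by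
    intro m
    refine lintegral_sup_partialSum_projection_le hε x hq₁ hq₂ N m (hB0 m) (le_trans ?_ (hB m))
    exact Finset.sum_le_sum fun n _ => lintegral_projection_le hε hind (hh n) _ m (hint n) hq₁
  have hbd : ∀ M : ℕ, ∫⁻ ω, (Finset.range (N + 1)).sup (fun n => ‖∑ t ∈ Finset.range n, x t ω‖ₑ) ∂μ
      ≤ ∑' m, 6 * ENNReal.ofReal (B m) + ∑ n ∈ Finset.range N,
        ∫⁻ ω, ‖(μ[x n | pastσ ε (((n + 1 : ℕ) : ℤ) - M)]) ω‖ₑ ∂μ := by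
    intro M
    calc _ ≤ ∫⁻ ω, (∑ m ∈ Finset.range M, S m ω + T M ω) ∂μ := lintegral_mono (hpt M)
      _ = ∑ m ∈ Finset.range M, ∫⁻ ω, S m ω ∂μ + ∑ n ∈ Finset.range N,
          ∫⁻ ω, ‖(μ[x n | pastσ ε (((n + 1 : ℕ) : ℤ) - M)]) ω‖ₑ ∂μ := by
        rw [lintegral_add_left (Finset.measurable_fun_sum _ fun m _ => hSm m),
          lintegral_finsetSum _ fun m _ => hSm m, lintegral_finsetSum _ fun n _ => (hcm _ _).enorm]
      _ ≤ _ := by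
        gcongr
        exact (Finset.sum_le_sum fun m _ => hS m).trans (ENNReal.sum_le_tsum _)
  -- The truncation `M` goes to infinity with `N` fixed, so bounding the remainder by a sum over all
  -- `n < N` loses nothing.
  have hlim : Tendsto (fun M : ℕ => ∑' m, 6 * ENNReal.ofReal (B m) + ∑ n ∈ Finset.range N,
      ∫⁻ ω, ‖(μ[x n | pastσ ε (((n + 1 : ℕ) : ℤ) - M)]) ω‖ₑ ∂μ) atTop
      (𝓝 (∑' m, 6 * ENNReal.ofReal (B m) + ∑ n ∈ Finset.range N, 0)) := by
    refine tendsto_const_nhds.add (tendsto_finsetSum _ fun n _ => ?_)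
    exact tendsto_lintegral_condExp_pastσ hε hind (hh n) _ (hint n) (hmean n)
  rw [Finset.sum_const_zero, add_zero] at hlim
  exact ge_of_tendsto' hlim hbd

end Projections

/-! ### Doob's inequality across series and dyadic Borel–Cantelli -/

section Doob

variable {Ω : Type*} [mΩ : MeasurableSpace Ω] {μ : Measure Ω} [IsProbabilityMeasure μ]

/-- The filtration `i ↦ F (min (i + 1) K)`. -/
def cappedFiltration (F : Filtration ℕ mΩ) (K : ℕ) : Filtration ℕ mΩ where
  seq i := F (min (i + 1) K)
  mono' i j h := F.mono (min_le_min_right K (by omega))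
  le' i := F.le _

/-- Doob's weak type inequality for the maximum of finitely many martingales indexed by
`1 ≤ i ≤ K`. -/
theorem mul_measure_sup_martingale_le (F : Filtration ℕ mΩ) {K N : ℕ} (hK : 1 ≤ K)
    {Y : ℕ → ℕ → Ω → ℝ}
    (hY : ∀ i ∈ Finset.Icc 1 K, ∀ n ≤ N, Measurable[F i] (Y i n))
    (hint : ∀ i ∈ Finset.Icc 1 K, ∀ n ≤ N, Integrable (Y i n) μ)
    (hmart : ∀ i, 1 ≤ i → i + 1 ≤ K → ∀ n ≤ N, μ[Y (i + 1) n | F i] =ᵐ[μ] Y i n) (c : ℝ≥0) :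
    c * μ {ω | (c : ℝ≥0∞) ≤ (Finset.Icc 1 K).sup fun i =>
        (Finset.range (N + 1)).sup fun n => ‖Y i n ω‖ₑ}
      ≤ ∫⁻ ω, (Finset.range (N + 1)).sup (fun n => ‖Y K n ω‖ₑ) ∂μ := by
  rcases eq_or_ne c 0 with rfl | hc
  · simp
  -- The shift makes index 0 correspond to the first series; the cap freezes the process at `K`,
  -- beyond which neither adaptedness nor the martingale property is available.
  let κ : ℕ → ℕ := fun i => min (i + 1) K
  have hκ : ∀ i, κ i ∈ Finset.Icc 1 K := fun i => by simp only [κ, Finset.mem_Icc]; omega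
  let f : ℕ → Ω → ℝ := fun i ω => (Finset.range (N + 1)).sup' Finset.nonempty_range_add_one
    fun n => |Y (κ i) n ω|
  have hle : ∀ i, ∀ n ≤ N, ∀ ω, |Y (κ i) n ω| ≤ f i ω := fun i n hn ω =>
    Finset.le_sup' (fun n => |Y (κ i) n ω|) (Finset.mem_range.2 (Nat.lt_succ_of_le hn))
  have hf0 : 0 ≤ f := fun i ω => (abs_nonneg _).trans (hle i 0 (Nat.zero_le _) ω)
  have hadp : StronglyAdapted (cappedFiltration F K) f := by
    intro i
    refine Measurable.stronglyMeasurable ?_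
    let := cappedFiltration F K i
    have : f i = (Finset.range (N + 1)).sup' Finset.nonempty_range_add_one
        fun n ω => |Y (κ i) n ω| := by
      ext ω; simp [f, Finset.sup'_apply]
    rw [this]
    refine Finset.measurable_range_sup' fun n hn => ?_
    exact (show Measurable (Y (κ i) n) from hY _ (hκ i) n hn).norm
  have hfint : ∀ i, Integrable (f i) μ := by
    intro i
    refine Integrable.mono' (g := fun ω => ∑ n ∈ Finset.range (N + 1), |Y (κ i) n ω|)
      (integrable_finsetSum _ fun n hn => (hint _ (hκ i) n
        (Nat.lt_succ_iff.1 (Finset.mem_range.1 hn))).abs)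
      ((hadp i).mono ((cappedFiltration F K).le i)).aestronglyMeasurable (ae_of_all _ fun ω => ?_)
    rw [Real.norm_of_nonneg (hf0 i ω)]
    exact Finset.sup'_le _ _ fun n hn =>
      Finset.single_le_sum (f := fun n => |Y (κ i) n ω|) (fun _ _ => abs_nonneg _) hn
  have hsub : Submartingale f (cappedFiltration F K) μ := by
    refine submartingale_nat hadp hfint fun i => ?_
    by_cases hi : i + 1 < K
    · have e1 : κ i = i + 1 := by simp only [κ]; omega
      have e2 : κ (i + 1) = i + 2 := by simp only [κ]; omega
      have e3 : (cappedFiltration F K) i = F (i + 1) := by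
        change F (κ i) = _
        rw [e1]
      have key : ∀ n ≤ N, ∀ᵐ ω ∂μ, |Y (κ i) n ω| ≤ (μ[f (i + 1) | F (i + 1)]) ω := by
        intro n hn
        have hi2 : i + 2 ∈ Finset.Icc 1 K := by rw [← e2]; exact hκ _
        have h1 := condExp_mono (m := F (i + 1)) (hint _ hi2 n hn) (hfint (i + 1))
          (ae_of_all _ fun ω => by
            have := hle (i + 1) n hn ω
            rw [e2] at this
            exact (le_abs_self _).trans this)
        have h2 := condExp_mono (m := F (i + 1)) (hint _ hi2 n hn).neg (hfint (i + 1))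
          (ae_of_all _ fun ω => by
            have := hle (i + 1) n hn ω
            rw [e2] at this
            exact (neg_le_abs _).trans this)
        have h3 := condExp_neg (μ := μ) (Y (i + 2) n) (F (i + 1))
        filter_upwards [h1, h2, h3, hmart (i + 1) (by omega) (by omega) n hn] with ω h1 h2 h3 h4
        rw [e1]
        rw [h3, Pi.neg_apply] at h2
        rw [h4] at h1 h2
        exact abs_le'.2 ⟨h1, h2⟩
      rw [e3]
      have key' : ∀ᵐ ω ∂μ, ∀ n ≤ N, |Y (κ i) n ω| ≤ (μ[f (i + 1) | F (i + 1)]) ω := by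
        rw [ae_all_iff]
        intro n
        by_cases hn : n ≤ N
        · filter_upwards [key n hn] with ω h _ using h
        · exact ae_of_all _ fun ω h => absurd h hn
      filter_upwards [key'] with ω h
      exact Finset.sup'_le _ _ fun n hn => h n (Nat.lt_succ_iff.1 (Finset.mem_range.1 hn))
    · have e : f (i + 1) = f i := by
        have : κ (i + 1) = κ i := by simp only [κ]; omega
        simp only [f, this]
      rw [e, condExp_of_stronglyMeasurable ((cappedFiltration F K).le i) (hadp i) (hfint i)]
  have hmax := maximal_ineq hsub hf0 (ε := c) (K - 1)
  have hκK : κ (K - 1) = K := by simp only [κ]; omega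
  calc _ ≤ c * μ {ω | (c : ℝ) ≤ (Finset.range (K - 1 + 1)).sup' Finset.nonempty_range_add_one
          fun i => f i ω} := by
        refine mul_le_mul' le_rfl (measure_mono fun ω hω => ?_)
        have hc' : (⊥ : ℝ≥0∞) < c := by simpa [pos_iff_ne_zero] using hc
        obtain ⟨i, hi, h1⟩ := (Finset.le_sup_iff hc').1 hω
        obtain ⟨n, hn, h2⟩ := (Finset.le_sup_iff hc').1 h1
        rw [Finset.mem_Icc] at hi
        have e : κ (i - 1) = i := by simp only [κ]; omega
        have h3 : (c : ℝ) ≤ |Y i n ω| := by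
          have : c ≤ ‖Y i n ω‖₊ := by exact_mod_cast h2
          exact_mod_cast this
        have h4 := hle (i - 1) n (Nat.lt_succ_iff.1 (Finset.mem_range.1 hn)) ω
        rw [e] at h4
        exact (h3.trans h4).trans (Finset.le_sup' (fun i => f i ω)
          (Finset.mem_range.2 (by omega)))
    _ ≤ ENNReal.ofReal (∫ ω, f (K - 1) ω ∂μ) := by
        refine hmax.trans (ENNReal.ofReal_le_ofReal ?_)
        exact setIntegral_le_integral (hfint _) (ae_of_all _ (hf0 _))
    _ = ∫⁻ ω, ENNReal.ofReal (f (K - 1) ω) ∂μ :=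
        ofReal_integral_eq_lintegral_ofReal (hfint _) (ae_of_all _ (hf0 _))
    _ ≤ _ := by
        refine lintegral_mono fun ω => ?_
        obtain ⟨n, hn, h⟩ := Finset.exists_mem_eq_sup' (Finset.nonempty_range_add_one (n := N))
          fun n => |Y (κ (K - 1)) n ω|
        simp only [f]
        rw [h, hκK, ← Real.enorm_eq_ofReal_abs]
        exact Finset.le_sup (f := fun n => ‖Y K n ω‖ₑ) hn

omit [IsProbabilityMeasure μ] in
/-- Almost sure convergence to zero from weak type bounds on dyadic block maxima. -/
theorem ae_tendsto_zero_of_dyadic {a A : ℝ} (ha : a < 1) {W : ℕ → Ω → ℝ≥0∞} {M : ℕ → Ω → ℝ≥0}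
    (hW : ∀ᶠ N : ℕ in atTop, ∀ c : ℝ≥0,
      c * μ {ω | (c : ℝ≥0∞) ≤ W N ω} ≤ ENNReal.ofReal (A * (N : ℝ) ^ a))
    (hM : ∀ j n ω, 2 ^ j ≤ n → n < 2 ^ (j + 1) → (M n ω : ℝ≥0∞) * 2 ^ j ≤ W (2 ^ (j + 1)) ω) :
    ∀ᵐ ω ∂μ, Tendsto (fun n => M n ω) atTop (𝓝 0) := by
  -- Half of the gap `1 - a` makes the probabilities summable and the other half makes the
  -- thresholds small: with `c j = 2^{j(1-γ)}` the bad events have probability `O(2^{-γj})`, and off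
  -- them `M n ≤ 2^{-γj}` on block `j`.
  set γ : ℝ := (1 - a) / 2 with hγ
  have hγ0 : 0 < γ := by rw [hγ]; linarith
  let c : ℕ → ℝ≥0 := fun j => ((2 : ℝ≥0) ^ j) ^ (1 - γ)
  have hc0 : ∀ j, 0 < c j := fun j => by positivity
  obtain ⟨N₀, hN₀⟩ := eventually_atTop.1 hW
  let s : ℕ → Set Ω := fun j => {ω | (c j : ℝ≥0∞) ≤ W (2 ^ (j + 1)) ω}
  have hN₀' : ∀ j, N₀ ≤ j → N₀ ≤ 2 ^ (j + 1) := fun j hj =>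
    hj.trans ((Nat.lt_two_pow_self).le.trans (Nat.pow_le_pow_right (by norm_num) (by omega)))
  have hs : ∀ j, N₀ ≤ j → μ (s j) ≤ ENNReal.ofReal (|A| * 2 ^ a * ((2 : ℝ) ^ (-γ)) ^ j) := by
    intro j hj
    have h1 := hN₀ (2 ^ (j + 1)) (hN₀' j hj) (c j)
    have hcE : (c j : ℝ≥0∞) = ENNReal.ofReal (c j : ℝ) := (ENNReal.ofReal_coe_nnreal).symm
    have h2 : μ (s j) ≤ ENNReal.ofReal (|A| * ((2 ^ (j + 1) : ℕ) : ℝ) ^ a) / c j := by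
      rw [ENNReal.le_div_iff_mul_le (Or.inl (by simpa using (hc0 j).ne')) (Or.inl (by simp)),
        mul_comm]
      refine h1.trans (ENNReal.ofReal_le_ofReal ?_)
      gcongr
      exact le_abs_self A
    refine h2.trans (le_of_eq ?_)
    rw [hcE, ← ENNReal.ofReal_div_of_pos (by exact_mod_cast hc0 j)]
    congr 1
    simp only [c]
    push_cast
    have e1 : ((2 : ℝ) ^ (j + 1)) ^ a = 2 ^ a * 2 ^ (a * j) := by
      rw [← Real.rpow_natCast, ← Real.rpow_mul (by norm_num), ← Real.rpow_add (by norm_num)]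
      congr 1; push_cast; ring
    have e2 : ((2 : ℝ) ^ j) ^ (1 - γ) = 2 ^ ((1 - γ) * j) := by
      rw [← Real.rpow_natCast, ← Real.rpow_mul (by norm_num)]
      congr 1; ring
    have e3 : ((2 : ℝ) ^ (-γ)) ^ j = 2 ^ (-γ * j) := by
      rw [← Real.rpow_natCast, ← Real.rpow_mul (by norm_num)]
    rw [e1, e2, e3, div_eq_iff (by positivity)]
    have e4 : (2 : ℝ) ^ (a * j) = 2 ^ (-γ * j) * 2 ^ ((1 - γ) * j) := by
      rw [← Real.rpow_add (by norm_num)]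
      congr 1
      rw [hγ]; ring
    rw [e4]; ring
  have hr : (2 : ℝ) ^ (-γ) < 1 := Real.rpow_lt_one_of_one_lt_of_neg (by norm_num) (by linarith)
  have hsum : ∑' j, μ (s (j + N₀)) ≠ ∞ := by
    have h1 : Summable fun j : ℕ => |A| * 2 ^ a * ((2 : ℝ) ^ (-γ)) ^ (j + N₀) :=
      ((summable_nat_add_iff N₀).2 (summable_geometric_of_lt_one (by positivity) hr)).mul_left _
    refine ne_top_of_le_ne_top ?_ (ENNReal.tsum_le_tsum fun j => hs (j + N₀) (by omega))
    exact h1.tsum_ofReal_ne_top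
  filter_upwards [ae_eventually_notMem hsum] with ω hω
  obtain ⟨J, hJ⟩ := eventually_atTop.1 hω
  have hbound : ∀ᶠ n : ℕ in atTop, (M n ω : ℝ) ≤ ((n : ℝ) / 2) ^ (-γ) := by
    filter_upwards [eventually_ge_atTop (2 ^ (J + N₀))] with n hn
    have hn0 : n ≠ 0 := (lt_of_lt_of_le (by positivity) hn).ne'
    set j := Nat.log 2 n with hj
    have hj1 : 2 ^ j ≤ n := Nat.pow_log_le_self 2 hn0
    have hj2 : n < 2 ^ (j + 1) := Nat.lt_pow_succ_log_self (by norm_num) n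
    have hj3 : J + N₀ ≤ j := Nat.le_log_of_pow_le (by norm_num) hn
    have h1 : ω ∉ s j := by
      have := hJ (j - N₀) (by omega)
      rwa [show j - N₀ + N₀ = j by omega] at this
    have h2 : (M n ω : ℝ≥0∞) * 2 ^ j < c j :=
      (hM j n ω hj1 hj2).trans_lt (not_le.1 h1)
    have h3 : M n ω * 2 ^ j < c j := by exact_mod_cast h2
    have h4 : (M n ω : ℝ) * 2 ^ j < ((2 : ℝ) ^ j) ^ (1 - γ) := by
      have := NNReal.coe_lt_coe.2 h3
      simp only [c] at this
      push_cast at this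
      exact this
    have h5 : ((2 : ℝ) ^ j) ^ (1 - γ) = ((2 : ℝ) ^ j) ^ (-γ) * 2 ^ j := by
      rw [sub_eq_neg_add, Real.rpow_add (by positivity), Real.rpow_one]
    rw [h5] at h4
    have h6 := lt_of_mul_lt_mul_right h4 (by positivity)
    refine h6.le.trans (Real.rpow_le_rpow_of_nonpos (by positivity) ?_ (by linarith))
    have : (n : ℝ) < 2 ^ (j + 1) := by exact_mod_cast hj2
    rw [pow_succ] at this
    linarith
  have hlim : Tendsto (fun n : ℕ => ((n : ℝ) / 2) ^ (-γ)) atTop (𝓝 0) :=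
    (tendsto_rpow_neg_atTop hγ0).comp (tendsto_natCast_atTop_atTop.atTop_div_const (by norm_num))
  have := tendsto_of_tendsto_of_tendsto_of_le_of_le' tendsto_const_nhds hlim
    (Eventually.of_forall fun n => NNReal.coe_nonneg (M n ω)) hbound
  exact NNReal.tendsto_coe.1 (by simpa using this)

end Doob

/-! ### Growth of the dependence weights -/

section Growth

theorem eventually_weight_le_of_weightSum {d : ℕ → ℕ → ℝ≥0} {b p : ℝ} {k : ℕ → ℕ} (hp : 0 < p)
    (hb : 0 ≤ b) (hsum : limsup (fun n => weightSum d b p (k n)) atTop < ∞) :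
    ∃ A : ℝ, 0 < A ∧ ∀ᶠ N : ℕ in atTop, ∀ i ∈ Finset.Icc 1 (k N),
      ∑ n ∈ Finset.range N, (d i (n + 1) : ℝ≥0∞) ^ p ≤ ENNReal.ofReal (A * (N : ℝ) ^ b) ^ p := by
  obtain ⟨V, hV, -⟩ := ENNReal.lt_iff_exists_nnreal_btwn.1 hsum
  -- Since `s ≤ N`, each `d_s^p` is at most `N^{bp} (d_s/s^b)^p`. Adding 1 to `V` keeps the constant
  -- positive.
  refine ⟨((V : ℝ) + 1) ^ p⁻¹, by positivity, ?_⟩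
  filter_upwards [eventually_lt_of_limsup_lt hV] with N hN i hi
  have hterm : ∀ n ∈ Finset.range N, (d i (n + 1) : ℝ≥0∞) ^ p ≤ (((N : ℝ≥0) ^ b) ^ p : ℝ≥0) *
      (((Finset.Icc 1 (k N)).sup fun i =>
        (d i (n + 1) / ((n + 1 : ℕ) : ℝ≥0) ^ b) ^ p : ℝ≥0) : ℝ≥0∞) := by
    intro n hn
    rw [← ENNReal.coe_rpow_of_nonneg _ hp.le, ← ENNReal.coe_mul, ENNReal.coe_le_coe]
    calc d i (n + 1) ^ p
        = (((n + 1 : ℕ) : ℝ≥0) ^ b) ^ p * (d i (n + 1) / ((n + 1 : ℕ) : ℝ≥0) ^ b) ^ p := by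
          rw [← NNReal.mul_rpow]
          congr 1
          field_simp
      _ ≤ _ := by
          refine mul_le_mul' (NNReal.rpow_le_rpow (NNReal.rpow_le_rpow ?_ hb) hp.le) ?_
          · exact_mod_cast Finset.mem_range.1 hn
          · exact Finset.le_sup (f := fun i =>
              (d i (n + 1) / ((n + 1 : ℕ) : ℝ≥0) ^ b) ^ p) hi
  calc _ ≤ ∑ n ∈ Finset.range N, (((N : ℝ≥0) ^ b) ^ p : ℝ≥0) *
      (((Finset.Icc 1 (k N)).sup fun i =>
        (d i (n + 1) / ((n + 1 : ℕ) : ℝ≥0) ^ b) ^ p : ℝ≥0) : ℝ≥0∞) := Finset.sum_le_sum hterm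
    _ ≤ (((N : ℝ≥0) ^ b) ^ p : ℝ≥0) * V := by
        rw [← Finset.mul_sum]
        gcongr
        exact (ENNReal.sum_le_tsum _).trans hN.le
    _ ≤ _ := by
        rw [ENNReal.ofReal_rpow_of_nonneg (by positivity) hp.le,
          Real.mul_rpow (by positivity) (by positivity), Real.rpow_inv_rpow (by positivity) hp.ne',
          ← ENNReal.coe_mul, ← ENNReal.ofReal_coe_nnreal]
        refine ENNReal.ofReal_le_ofReal ?_
        push_cast
        have : 0 ≤ ((N : ℝ) ^ b) ^ p := by positivity
        nlinarith

/-- Serves `p > 2`, where squares of the weights are needed and Hölder's inequality on the `p`-th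
power sum would cost `N^{1/2 - 1/p}`. Instead the moment growth gives `d ≤ 2 N^{1-b}`, and `N` such
squares add up to `4 N^{3-2b}`. -/
theorem eventually_weight_le_of_maxMoment {Ω : Type*} [MeasurableSpace Ω] {μ : Measure Ω}
    {x : ℕ → ℕ → Ω → ℝ} {d : ℕ → ℕ → ℝ≥0} {b p : ℝ} {k : ℕ → ℕ} (hp : 0 < p)
    (hd : ∀ i ≥ 1, ∀ t ≥ 1, (d i t : ℝ≥0∞) ≤ 2 * eLpNorm (x i t) (ENNReal.ofReal p) μ)
    (hmom : Tendsto
      (fun n : ℕ => maxMoment μ p x k n / ENNReal.ofReal ((n : ℝ) ^ (p * (1 - b))))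
      atTop (𝓝 0)) :
    ∀ᶠ N : ℕ in atTop, ∀ i ∈ Finset.Icc 1 (k N),
      ∑ n ∈ Finset.range N, (d i (n + 1) : ℝ≥0∞) ^ (2 : ℝ)
        ≤ ENNReal.ofReal (2 * (N : ℝ) ^ (3 / 2 - b)) ^ (2 : ℝ) := by
  filter_upwards [hmom.eventually_lt_const zero_lt_one, eventually_gt_atTop 0] with N hN hN0 i hi
  have hNr : (0 : ℝ) < N := by exact_mod_cast hN0
  have hpos : ENNReal.ofReal ((N : ℝ) ^ (p * (1 - b))) ≠ 0 := by
    rw [ne_eq, ENNReal.ofReal_eq_zero, not_le]; positivity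
  have hM : maxMoment μ p x k N ≤ ENNReal.ofReal ((N : ℝ) ^ (p * (1 - b))) := by
    have := (ENNReal.div_le_iff hpos ENNReal.ofReal_ne_top).1 hN.le
    rwa [one_mul] at this
  have hterm : ∀ n ∈ Finset.range N,
      (d i (n + 1) : ℝ≥0∞) ^ (2 : ℝ) ≤ ENNReal.ofReal (4 * (N : ℝ) ^ (2 * (1 - b))) := by
    intro n hn
    have h1 : ∫⁻ ω, ‖x i (n + 1) ω‖ₑ ^ p ∂μ ≤ ENNReal.ofReal ((N : ℝ) ^ (p * (1 - b))) := by
      refine le_trans ?_ hM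
      refine le_trans ?_ (Finset.le_sup (f := fun i => (Finset.Icc 1 N).sup fun t =>
        ∫⁻ ω, ‖x i t ω‖ₑ ^ p ∂μ) hi)
      refine Finset.le_sup (f := fun t => ∫⁻ ω, ‖x i t ω‖ₑ ^ p ∂μ) ?_
      have := Finset.mem_range.1 hn
      exact Finset.mem_Icc.2 ⟨by omega, by omega⟩
    have h2 : eLpNorm (x i (n + 1)) (ENNReal.ofReal p) μ ≤ ENNReal.ofReal ((N : ℝ) ^ (1 - b)) := by
      rw [eLpNorm_eq_lintegral_rpow_enorm_toReal (by simpa using hp) ENNReal.ofReal_ne_top,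
        ENNReal.toReal_ofReal hp.le]
      calc _ ≤ (ENNReal.ofReal ((N : ℝ) ^ (p * (1 - b)))) ^ (1 / p) := by gcongr
        _ = _ := by
          rw [ENNReal.ofReal_rpow_of_pos (by positivity), ← Real.rpow_mul hNr.le]
          congr 2
          field_simp
    calc (d i (n + 1) : ℝ≥0∞) ^ (2 : ℝ) ≤ (ENNReal.ofReal (2 * (N : ℝ) ^ (1 - b))) ^ (2 : ℝ) := by
          refine ENNReal.rpow_le_rpow ?_ (by norm_num)
          rw [ENNReal.ofReal_mul (by norm_num)]
          refine ((hd i (Finset.mem_Icc.1 hi).1 (n + 1) (by omega)).trans ?_)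
          rw [ENNReal.ofReal_ofNat]
          gcongr
      _ = _ := by
          rw [ENNReal.ofReal_rpow_of_nonneg (by positivity) (by norm_num),
            Real.mul_rpow (by norm_num) (by positivity), ← Real.rpow_mul hNr.le]
          rw [mul_comm (1 - b) 2]
          norm_num
  calc _ ≤ ∑ n ∈ Finset.range N, ENNReal.ofReal (4 * (N : ℝ) ^ (2 * (1 - b))) :=
        Finset.sum_le_sum hterm
    _ = ENNReal.ofReal (N * (4 * (N : ℝ) ^ (2 * (1 - b)))) := by
        rw [Finset.sum_const, Finset.card_range, nsmul_eq_mul, ENNReal.ofReal_mul hNr.le,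
          ENNReal.ofReal_natCast]
    _ = _ := by
        rw [ENNReal.ofReal_rpow_of_nonneg (by positivity) (by norm_num),
          Real.mul_rpow (by norm_num) (by positivity), ← Real.rpow_mul hNr.le]
        have e : (N : ℝ) ^ ((3 / 2 - b) * 2) = N * (N : ℝ) ^ (2 * (1 - b)) := by
          rw [show (3 / 2 - b) * 2 = 1 + 2 * (1 - b) by ring, Real.rpow_add hNr, Real.rpow_one]
        rw [e]
        norm_num
        ring_nf

end Growth

/-! ### Assembly -/

section Main

variable {Ω E : Type*} [MeasurableSpace Ω] [MeasurableSpace E] {μ : Measure Ω}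
  [IsProbabilityMeasure μ]

theorem lintegral_rpow_le_physDep {p q : ℝ} (hq : 1 ≤ q) (hqp : q ≤ p)
    {ε : ℕ → ℤ → Ω → E} (hε : ∀ i s, Measurable (ε i s)) {g : ℕ → ℕ → (ℕ → E) → ℝ}
    (hg : ∀ i t, Measurable (g i t)) (i t m : ℕ) :
    ∫⁻ w, ‖g i t (pastSeq (ε i) t w.1)
        - g i t (fun j : ℕ => if j = m then ε i ((t : ℤ) - j) w.2
          else ε i ((t : ℤ) - j) w.1)‖ₑ ^ q ∂(μ.prod μ)
      ≤ physDep μ p g ε i t m ^ q := by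
  have hq0 : 0 < q := by linarith
  have hm1 : Measurable fun w : Ω × Ω => g i t (pastSeq (ε i) t w.1) :=
    (hg i t).comp ((measurable_pastSeq (hε i) t).comp measurable_fst)
  have hm2 : Measurable fun w : Ω × Ω => g i t (fun j : ℕ =>
      if j = m then ε i ((t : ℤ) - j) w.2 else ε i ((t : ℤ) - j) w.1) := by
    refine (hg i t).comp (measurable_pi_lambda _ fun j => ?_)
    split_ifs
    · exact (hε i _).comp measurable_snd
    · exact (hε i _).comp measurable_fst
  have h1 : eLpNorm (fun w : Ω × Ω => g i t (pastSeq (ε i) t w.1)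
        - g i t (fun j : ℕ => if j = m then ε i ((t : ℤ) - j) w.2
          else ε i ((t : ℤ) - j) w.1)) (ENNReal.ofReal q) (μ.prod μ) ≤ physDep μ p g ε i t m :=
    eLpNorm_le_eLpNorm_of_exponent_le (ENNReal.ofReal_le_ofReal hqp)
      (hm1.sub hm2).aestronglyMeasurable
  rw [eLpNorm_eq_lintegral_rpow_enorm_toReal (by simpa using hq0) ENNReal.ofReal_ne_top,
    ENNReal.toReal_ofReal hq0.le, one_div] at h1
  refine le_trans (le_of_eq ?_) (ENNReal.rpow_le_rpow h1 hq0.le)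
  rw [ENNReal.rpow_inv_rpow hq0.ne']

/-- A maximal inequality for the partial sums of one causal series under physical dependence. -/
theorem lintegral_sup_causalProcess_le {p q : ℝ} (hq₁ : 1 ≤ q) (hq₂ : q ≤ 2) (hqp : q ≤ p)
    {ε : ℕ → ℤ → Ω → E} (hε : ∀ i s, Measurable (ε i s))
    {g : ℕ → ℕ → (ℕ → E) → ℝ} (hg : ∀ i t, Measurable (g i t)) {i : ℕ}
    (hind : iIndepFun (ε i) μ)
    (hint : ∀ t ≥ 1, Integrable (causalProcess g ε i t) μ)
    (hmean : ∀ t ≥ 1, ∫ ω, causalProcess g ε i t ω ∂μ = 0)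
    {d : ℕ → ℝ≥0} {ψ : ℕ → ℝ≥0}
    (hθ : ∀ t ≥ 1, ∀ m, physDep μ p g ε i t m ≤ (d t : ℝ≥0∞) * (ψ m : ℝ≥0∞))
    {ρ : ℕ → ℝ} (hρ0 : ∀ m, 0 < ρ m) (hρ : ∀ m, (ψ m : ℝ) ≤ ρ m) {N : ℕ} {A : ℝ} (hA : 0 < A)
    (hd : ∑ n ∈ Finset.range N, (d (n + 1) : ℝ≥0∞) ^ q ≤ ENNReal.ofReal A ^ q) :
    ∫⁻ ω, (Finset.range (N + 1)).sup (fun n =>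
      ‖∑ t ∈ Finset.range n, causalProcess g ε i (t + 1) ω‖ₑ) ∂μ
      ≤ ENNReal.ofReal A * ∑' m, 6 * ENNReal.ofReal (ρ m) := by
  have hq0 : 0 ≤ q := by linarith
  have key := lintegral_sup_causal_le (μ := μ) (hε i) hind (h := fun n => g i (n + 1))
    (fun n => hg i (n + 1)) (fun n => hint (n + 1) (by omega)) (fun n => hmean (n + 1) (by omega))
    hq₁ hq₂ N (B := fun m => A * ρ m) (fun m => mul_pos hA (hρ0 m)) (fun m => ?_)
  · refine key.trans (le_of_eq ?_)
    rw [← ENNReal.tsum_mul_left]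
    refine tsum_congr fun m => ?_
    rw [ENNReal.ofReal_mul hA.le]; ring
  · calc _ ≤ ∑ n ∈ Finset.range N, (ψ m : ℝ≥0∞) ^ q * (d (n + 1) : ℝ≥0∞) ^ q := by
          refine Finset.sum_le_sum fun n _ => ?_
          refine (lintegral_rpow_le_physDep hq₁ hqp hε hg i (n + 1) m).trans ?_
          rw [← ENNReal.mul_rpow_of_nonneg _ _ hq0, mul_comm]
          exact ENNReal.rpow_le_rpow (hθ (n + 1) (by omega) m) hq0
      _ ≤ ENNReal.ofReal (ρ m) ^ q * ENNReal.ofReal A ^ q := by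
          rw [← Finset.mul_sum]
          refine mul_le_mul' (ENNReal.rpow_le_rpow ?_ hq0) hd
          rw [← ENNReal.ofReal_coe_nnreal]
          exact ENNReal.ofReal_le_ofReal (hρ m)
      _ = _ := by
          rw [← ENNReal.mul_rpow_of_nonneg _ _ hq0, mul_comm, ← ENNReal.ofReal_mul hA.le]

theorem summable_max_rpow {s : ℝ} (hs : 1 < s) :
    Summable fun m : ℕ => (max (m : ℝ) 1) ^ (-s) := by
  rw [← summable_nat_add_iff 1]
  have h := (summable_nat_add_iff 1).2 (Real.summable_nat_rpow.2 (show -s < -1 by linarith))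
  refine h.congr fun m => ?_
  rw [max_eq_left (by push_cast; linarith [(Nat.cast_nonneg m : (0 : ℝ) ≤ m)])]

omit [MeasurableSpace Ω] in
-- Monotonicity of `k` lets the right end of the dyadic block cover every series in play, and `n ≥
-- 2^j` turns averages into partial sums.
theorem maxMean_mul_two_pow_le {x : ℕ → ℕ → Ω → ℝ} {k : ℕ → ℕ} (hk : Monotone k) (j n : ℕ)
    (ω : Ω) (h₁ : 2 ^ j ≤ n) (h₂ : n < 2 ^ (j + 1)) :
    (maxMean x k n ω : ℝ≥0∞) * 2 ^ j ≤ (Finset.Icc 1 (k (2 ^ (j + 1)))).sup fun i =>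
      (Finset.range (2 ^ (j + 1) + 1)).sup fun n => ‖∑ t ∈ Finset.range n, x i (t + 1) ω‖ₑ := by
  have hn0 : 0 < n := lt_of_lt_of_le (by positivity) h₁
  rcases Finset.eq_empty_or_nonempty (Finset.Icc 1 (k n)) with he | hne
  · simp [maxMean, he]
  obtain ⟨i, hi, hsup⟩ := Finset.exists_mem_eq_sup (Finset.Icc 1 (k n)) hne
    fun i => ‖(1 / (n : ℝ)) * ∑ t ∈ Finset.Icc 1 n, x i t ω‖₊
  have hi' : i ∈ Finset.Icc 1 (k (2 ^ (j + 1))) :=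
    Finset.Icc_subset_Icc_right (hk h₂.le) hi
  have hsum : ∑ t ∈ Finset.Icc 1 n, x i t ω = ∑ t ∈ Finset.range n, x i (t + 1) ω := by
    rw [Finset.range_eq_Ico, Finset.sum_Ico_add' (fun t => x i t ω) 0 n 1]
    rfl
  have h3 : ‖(1 / (n : ℝ)) * ∑ t ∈ Finset.Icc 1 n, x i t ω‖₊ * 2 ^ j
      ≤ ‖∑ t ∈ Finset.range n, x i (t + 1) ω‖₊ := by
    rw [← NNReal.coe_le_coe, hsum]
    push_cast
    rw [norm_mul, Real.norm_of_nonneg (by positivity)]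
    have h4 : (2 : ℝ) ^ j ≤ n := by exact_mod_cast h₁
    have hnr : (0 : ℝ) < n := by exact_mod_cast hn0
    calc 1 / (n : ℝ) * ‖∑ t ∈ Finset.range n, x i (t + 1) ω‖ * 2 ^ j
        ≤ 1 / (n : ℝ) * ‖∑ t ∈ Finset.range n, x i (t + 1) ω‖ * n := by gcongr
      _ = _ := by field_simp
  calc (maxMean x k n ω : ℝ≥0∞) * 2 ^ j
      = ((‖(1 / (n : ℝ)) * ∑ t ∈ Finset.Icc 1 n, x i t ω‖₊ * 2 ^ j : ℝ≥0) : ℝ≥0∞) := by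
        rw [maxMean, hsup]; push_cast; rfl
    _ ≤ ‖∑ t ∈ Finset.range n, x i (t + 1) ω‖ₑ := by exact_mod_cast h3
    _ ≤ _ := by
        refine le_trans ?_ (Finset.le_sup (f := fun i => (Finset.range (2 ^ (j + 1) + 1)).sup
          fun n => ‖∑ t ∈ Finset.range n, x i (t + 1) ω‖ₑ) hi')
        exact Finset.le_sup (f := fun n => ‖∑ t ∈ Finset.range n, x i (t + 1) ω‖ₑ)
          (Finset.mem_range.2 (by omega))

theorem mul_measure_sup_partialSum_le {x : ℕ → ℕ → Ω → ℝ} {K N : ℕ} (hK : 1 ≤ K)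
    (hint : ∀ i ≥ 1, ∀ t ≥ 1, Integrable (x i t) μ)
    (F : Filtration ℕ (inferInstance : MeasurableSpace Ω))
    (hadapted : ∀ i ∈ Finset.Icc 1 K, ∀ t ∈ Finset.Icc 1 N, Measurable[F i] (x i t))
    (hmart : ∀ i, 1 ≤ i → i + 1 ≤ K → ∀ t ∈ Finset.Icc 1 N, μ[x (i + 1) t | F i] =ᵐ[μ] x i t)
    (c : ℝ≥0) :
    c * μ {ω | (c : ℝ≥0∞) ≤ (Finset.Icc 1 K).sup fun i =>
        (Finset.range (N + 1)).sup fun n => ‖∑ t ∈ Finset.range n, x i (t + 1) ω‖ₑ}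
      ≤ ∫⁻ ω, (Finset.range (N + 1)).sup
        (fun n => ‖∑ t ∈ Finset.range n, x K (t + 1) ω‖ₑ) ∂μ := by
  refine mul_measure_sup_martingale_le F hK
    (Y := fun i n ω => ∑ t ∈ Finset.range n, x i (t + 1) ω) (fun i hi n hn => ?_)
    (fun i hi n hn => integrable_finsetSum _ fun t _ => hint i (Finset.mem_Icc.1 hi).1 _ (by omega))
    (fun i hi hiK n hn => ?_) c
  · let := F i
    refine Finset.measurable_fun_sum _ fun t ht => ?_
    have := Finset.mem_range.1 ht
    exact hadapted i hi (t + 1) (Finset.mem_Icc.2 ⟨by omega, by omega⟩)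
  · have h1 := condExp_finsetSum (μ := μ) (s := Finset.range n) (f := fun t => x (i + 1) (t + 1))
      (fun t _ => hint (i + 1) (by omega) (t + 1) (by omega)) (F i)
    have e : (fun ω => ∑ t ∈ Finset.range n, x (i + 1) (t + 1) ω)
        = ∑ t ∈ Finset.range n, x (i + 1) (t + 1) := by ext ω; simp
    have h2 : ∀ᵐ ω ∂μ, ∀ t ∈ Finset.range n, (μ[x (i + 1) (t + 1) | F i]) ω = x i (t + 1) ω := by
      refine (Finset.eventually_all _).2 fun t ht => ?_
      have := Finset.mem_range.1 ht
      exact hmart i hi hiK (t + 1) (Finset.mem_Icc.2 ⟨by omega, by omega⟩)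
    rw [e]
    filter_upwards [h1, h2] with ω h1 h2
    rw [h1, Finset.sum_apply]
    exact Finset.sum_congr rfl h2

end Main

end MaxLLN

theorem mainTheorem6
    {Ω E : Type*} [MeasurableSpace Ω] [MeasurableSpace E]
    (μ : Measure Ω) [IsProbabilityMeasure μ]
    (p b : ℝ) (hp : 1 < p) (hb₁ : 1 / min p 2 < b) (hb₂ : b < 1)
    -- the dimension sequence
    (k : ℕ → ℕ) (hk : Monotone k)
    -- for each `i`, iid innovations, and measurable response functions
    (ε : ℕ → ℤ → Ω → E) (hε : ∀ i s, Measurable (ε i s))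
    (hindep : ∀ i, iIndepFun (fun s : ℤ => ε i s) μ)
    (hident : ∀ i s, IdentDistrib (ε i s) (ε i 0) μ μ)
    (g : ℕ → ℕ → (ℕ → E) → ℝ) (hg : ∀ i t, Measurable (g i t))
    (x : ℕ → ℕ → Ω → ℝ) (hx : x = MaxLLN.causalProcess g ε)
    (hLp : ∀ i ≥ 1, ∀ t ≥ 1, MemLp (x i t) (ENNReal.ofReal p) μ)
    (hmean : ∀ i ≥ 1, ∀ t ≥ 1, ∫ ω, x i t ω ∂μ = 0)
    -- physical dependence over `t`
    (hΘ : ∀ i ≥ 1, ∀ t ≥ 1, MaxLLN.accPhysDep μ p g ε i t < ∞)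
    (d ψ : ℕ → ℕ → ℝ≥0)
    (hθ : ∀ i ≥ 1, ∀ t ≥ 1, ∀ m,
      MaxLLN.physDep μ p g ε i t m ≤ (d i t : ℝ≥0∞) * (ψ i m : ℝ≥0∞))
    (hd : 2 < p → ∀ i ≥ 1, ∀ t ≥ 1,
      (d i t : ℝ≥0∞) ≤ 2 * eLpNorm (x i t) (ENNReal.ofReal p) μ)
    (lam ι C : ℝ) (hlam : 1 ≤ lam) (hι : 0 < ι)
    (hψ : ∀ i ≥ 1, ∀ m : ℕ, (ψ i m : ℝ) ≤ C * (max (m : ℝ) 1) ^ (-lam - ι))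
    -- martingale over `i`
    (F : ℕ → Filtration ℕ (inferInstance : MeasurableSpace Ω))
    (hadapted : ∀ n, ∀ i ∈ Finset.Icc 1 (k n), ∀ t ∈ Finset.Icc 1 n,
      Measurable[F n i] (x i t))
    (hmart : ∀ n i, 1 ≤ i → i + 1 ≤ k n → ∀ t ∈ Finset.Icc 1 n,
      μ[x (i + 1) t | F n i] =ᵐ[μ] x i t)
    -- summability and moment growth
    (hsum : limsup (fun n => MaxLLN.weightSum d b p (k n)) atTop < ∞)
    (hmom : Tendsto
      (fun n : ℕ => MaxLLN.maxMoment μ p x k n / ENNReal.ofReal ((n : ℝ) ^ (p * (1 - b))))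
      atTop (𝓝 0)) :
    ∀ᵐ ω ∂μ, Tendsto (fun n => MaxLLN.maxMean x k n ω) atTop (𝓝 0) := by
  have hp0 : 0 < p := by linarith
  have hint : ∀ i ≥ 1, ∀ t ≥ 1, Integrable (x i t) μ := fun i hi t ht =>
    (hLp i hi t ht).integrable (ENNReal.one_le_ofReal.2 hp.le)
  set q : ℝ := min p 2 with hq
  have hq₁ : 1 ≤ q := le_min hp.le (by norm_num)
  have hq₂ : q ≤ 2 := min_le_right _ _
  have hqp : q ≤ p := min_le_left _ _
  obtain ⟨a, A, ha, hA, hdA⟩ : ∃ a A : ℝ, a < 1 ∧ 0 < A ∧ ∀ᶠ N : ℕ in atTop,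
      ∀ i ∈ Finset.Icc 1 (k N), ∑ n ∈ Finset.range N, (d i (n + 1) : ℝ≥0∞) ^ q
        ≤ ENNReal.ofReal (A * (N : ℝ) ^ a) ^ q := by
    rcases le_or_gt p 2 with h | h
    · have e : q = p := min_eq_left h
      have hb0 : 0 ≤ b := le_trans (by positivity) hb₁.le
      obtain ⟨A, hA, hev⟩ := MaxLLN.eventually_weight_le_of_weightSum hp0 hb0 hsum
      exact ⟨b, A, hb₂, hA, by rwa [e]⟩
    · have e : q = 2 := min_eq_right h.le
      rw [e] at hb₁
      -- Here `b > 1/2`, which is exactly `3/2 - b < 1`.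
      refine ⟨3 / 2 - b, 2, by linarith, by norm_num, ?_⟩
      rw [e]
      exact MaxLLN.eventually_weight_le_of_maxMoment hp0 (hd h) hmom
  -- A strictly positive majorant of `ψ`, uniform in `i`: the maximal inequality divides by its
  -- bound. It is summable because `lam + ι > 1`.
  let ρ : ℕ → ℝ := fun m => (|C| + 1) * (max (m : ℝ) 1) ^ (-lam - ι)
  have hbase : ∀ m : ℕ, (0 : ℝ) < max (m : ℝ) 1 := fun m => lt_max_of_lt_right one_pos
  have hρ0 : ∀ m, 0 < ρ m := fun m =>
    mul_pos (by positivity) (Real.rpow_pos_of_pos (hbase m) _)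
  have hρ : ∀ i ≥ 1, ∀ m, (ψ i m : ℝ) ≤ ρ m := fun i hi m =>
    (hψ i hi m).trans (mul_le_mul_of_nonneg_right (by linarith [le_abs_self C])
      (Real.rpow_pos_of_pos (hbase m) _).le)
  have hρs : Summable ρ := by
    have h := MaxLLN.summable_max_rpow (show 1 < lam + ι by linarith)
    rw [neg_add'] at h
    exact h.mul_left _
  have htsum : ∑' m, 6 * ENNReal.ofReal (ρ m) = ENNReal.ofReal (6 * ∑' m, ρ m) := by
    rw [ENNReal.tsum_mul_left, ENNReal.ofReal_mul (by norm_num),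
      ENNReal.ofReal_tsum_of_nonneg (fun m => (hρ0 m).le) hρs]
    norm_num
  refine MaxLLN.ae_tendsto_zero_of_dyadic (a := a) (A := A * (6 * ∑' m, ρ m)) ha
    (W := fun N ω => (Finset.Icc 1 (k N)).sup fun i =>
      (Finset.range (N + 1)).sup fun n => ‖∑ t ∈ Finset.range n, x i (t + 1) ω‖ₑ) ?_
    (fun j n ω h₁ h₂ => MaxLLN.maxMean_mul_two_pow_le hk j n ω h₁ h₂)
  filter_upwards [hdA, eventually_gt_atTop 0] with N hN hN0 c
  rcases Nat.eq_zero_or_pos (k N) with h0 | hK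
  · rcases eq_or_ne c 0 with rfl | hc
    · simp
    · have : {ω : Ω | (c : ℝ≥0∞) ≤ (Finset.Icc 1 (k N)).sup fun i =>
          (Finset.range (N + 1)).sup fun n => ‖∑ t ∈ Finset.range n, x i (t + 1) ω‖ₑ} = ∅ := by
        ext ω
        simp [h0, hc]
      rw [this]
      simp
  -- From here on only the single series `k N` remains.
  refine (MaxLLN.mul_measure_sup_partialSum_le hK hint (F N) (hadapted N) (hmart N) c).trans ?_
  have hNr : (0 : ℝ) < N := by exact_mod_cast hN0
  subst hx
  refine (MaxLLN.lintegral_sup_causalProcess_le hq₁ hq₂ hqp hε hg (hindep (k N))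
    (hint (k N) hK) (hmean (k N) hK) (hθ (k N) hK) hρ0 (hρ (k N) hK)
    (A := A * (N : ℝ) ^ a) (by positivity) (hN (k N) (Finset.mem_Icc.2 ⟨hK, le_rfl⟩))).trans
    (le_of_eq ?_)
  rw [htsum, ← ENNReal.ofReal_mul (by positivity)]
  congr 1
  ring
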